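/- For real $p>1$ define Ball's function $$f(p):=\sqrt{\frac p2}\;\frac2\pi\int_0^\infty\left|\frac{\sin t}{t}\right|^p\,dt .$$ The integral converges for every $p>1$, so that $f$ is a well-defined function from $(1,\infty)$ to the positive reals, and the following hold. (a) $\lim_{p\to\infty} f(p)=\sqrt{\frac3\pi}$, and $f\left(\frac94\right)<\sqrt{\frac3\pi}$. (b) $f\left(\sqrt2+\frac12\right)<\frac{51}{50}$. (c) The restriction of $f$ to $\left[\sqrt2+\frac12,\frac94\right]$ is (strictly) decreasing and convex. -/

import Mathlib

/-- Ball's integral function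
`f(p) = √(p/2) · (2/π) · ∫_0^∞ |sin t / t|^p dt`, meant for real `p > 1`
(there the integral converges, which is asserted separately where the function is used). -/
noncomputable def ballFunction (p : ℝ) : ℝ :=
  Real.sqrt (p / 2) * (2 / Real.pi) *
    ∫ t in Set.Ioi (0 : ℝ), |Real.sin t / t| ^ p

namespace BallFunction
open Real Set MeasureTheory Filter Topology

/-! Write s(t) = |sin t / t| and I(p) for the integral of s^p over the half line, so that f(p) =
√(p/2) (2/π) I(p).

Limit: after t = x/√p the integrand of √p I(p) tends to exp(-x²/6) and is dominated by 12/(1+x²),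
which leaves a Gaussian integral.

Numerical values: both are reached by comparison with the exact value I(2) = π/2. The difference of
the two powers of s is bounded on (0, 3) or (0, 3.14) by an even polynomial, integrated exactly.
Beyond π it is bounded by negative powers of t times a cosine polynomial, whose oscillating terms
are controlled by two integrations by parts (`integral_cos_mul_tail`).

Convexity: with l = -log s, the second derivative of √p e^{-pl} is p^{-3/2} c(pl), where c(x) = (x²
- x - 1/4) e^{-x}. This is negative for small t, so convexity fails pointwise. But c(pl(t)) ≥ k(t)
for some k independent of p with ∫ k ≥ 0. Since (√p)'' = -p^{-3/2}/4, each √p s^p + 4k√p is convex.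
Integrating and adding the convex function -4(∫ k)√p gives convexity of √p I(p).

Monotonicity: a convex function is strictly decreasing once its right endpoint value lies strictly
below all nearby values. Near 9/4 this follows from the tangent inequality e^y ≥ 1 + y under the
integral (`sincIntegral_ge_tangent`). -/

/-! ### Taylor bounds for sine and cosine -/

/-- The induction step for the Taylor bounds below: the derivative of each error term is the
preceding error term. -/
theorem nonneg_of_hasDerivAt_nonneg {f f' : ℝ → ℝ} (hf : ∀ x, HasDerivAt f (f' x) x)
    (h0 : f 0 = 0) (hf' : ∀ x, 0 ≤ x → 0 ≤ f' x) {x : ℝ} (hx : 0 ≤ x) : 0 ≤ f x := by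
  have hmono : MonotoneOn f (Ici 0) := by
    apply monotoneOn_of_deriv_nonneg (convex_Ici 0)
    · exact fun y _ => (hf y).continuousAt.continuousWithinAt
    · exact fun y _ => (hf y).differentiableAt.differentiableWithinAt
    · intro y hy
      rw [interior_Ici] at hy
      rw [(hf y).deriv]
      exact hf' y (le_of_lt hy)
  rw [← h0]
  exact hmono (mem_Ici.2 le_rfl) (mem_Ici.2 hx) hx

theorem cos_le_quartic {x : ℝ} (hx : 0 ≤ x) : cos x ≤ 1 - x ^ 2 / 2 + x ^ 4 / 24 := by
  have := nonneg_of_hasDerivAt_nonneg (f := fun x => 1 - x ^ 2 / 2 + x ^ 4 / 24 - cos x)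
    (f' := fun x => sin x - (x - x ^ 3 / 6)) (fun x => by
      refine HasDerivAt.congr_deriv ((((hasDerivAt_const x (1 : ℝ)).sub
        ((hasDerivAt_pow 2 x).div_const 2)).add ((hasDerivAt_pow 4 x).div_const 24)).sub
        (hasDerivAt_cos x)) ?_
      push_cast; ring) (by simp) (fun x hx => by linarith [sin_ge_sub_cube hx]) hx
  linarith

theorem sin_le_quintic {x : ℝ} (hx : 0 ≤ x) : sin x ≤ x - x ^ 3 / 6 + x ^ 5 / 120 := by
  have := nonneg_of_hasDerivAt_nonneg (f := fun x => x - x ^ 3 / 6 + x ^ 5 / 120 - sin x)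
    (f' := fun x => 1 - x ^ 2 / 2 + x ^ 4 / 24 - cos x) (fun x => by
      refine HasDerivAt.congr_deriv ((((hasDerivAt_id x).sub
        ((hasDerivAt_pow 3 x).div_const 6)).add ((hasDerivAt_pow 5 x).div_const 120)).sub
        (hasDerivAt_sin x)) ?_
      push_cast; ring) (by simp) (fun x hx => by linarith [cos_le_quartic hx]) hx
  linarith

theorem cos_ge_sextic {x : ℝ} (hx : 0 ≤ x) : 1 - x ^ 2 / 2 + x ^ 4 / 24 - x ^ 6 / 720 ≤ cos x := by
  have := nonneg_of_hasDerivAt_nonneg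
    (f := fun x => cos x - (1 - x ^ 2 / 2 + x ^ 4 / 24 - x ^ 6 / 720))
    (f' := fun x => x - x ^ 3 / 6 + x ^ 5 / 120 - sin x) (fun x => by
      refine HasDerivAt.congr_deriv ((hasDerivAt_cos x).sub ((((hasDerivAt_const x (1 : ℝ)).sub
        ((hasDerivAt_pow 2 x).div_const 2)).add ((hasDerivAt_pow 4 x).div_const 24)).sub
        ((hasDerivAt_pow 6 x).div_const 720))) ?_
      push_cast; ring) (by simp) (fun x hx => by linarith [sin_le_quintic hx]) hx
  linarith

theorem sin_ge_septic {x : ℝ} (hx : 0 ≤ x) :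
    x - x ^ 3 / 6 + x ^ 5 / 120 - x ^ 7 / 5040 ≤ sin x := by
  have := nonneg_of_hasDerivAt_nonneg
    (f := fun x => sin x - (x - x ^ 3 / 6 + x ^ 5 / 120 - x ^ 7 / 5040))
    (f' := fun x => cos x - (1 - x ^ 2 / 2 + x ^ 4 / 24 - x ^ 6 / 720)) (fun x => by
      refine HasDerivAt.congr_deriv ((hasDerivAt_sin x).sub ((((hasDerivAt_id x).sub
        ((hasDerivAt_pow 3 x).div_const 6)).add ((hasDerivAt_pow 5 x).div_const 120)).sub
        ((hasDerivAt_pow 7 x).div_const 5040))) ?_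
      push_cast; ring) (by simp) (fun x hx => by linarith [cos_ge_sextic hx]) hx
  linarith

theorem cos_le_octic {x : ℝ} (hx : 0 ≤ x) :
    cos x ≤ 1 - x ^ 2 / 2 + x ^ 4 / 24 - x ^ 6 / 720 + x ^ 8 / 40320 := by
  have := nonneg_of_hasDerivAt_nonneg
    (f := fun x => 1 - x ^ 2 / 2 + x ^ 4 / 24 - x ^ 6 / 720 + x ^ 8 / 40320 - cos x)
    (f' := fun x => sin x - (x - x ^ 3 / 6 + x ^ 5 / 120 - x ^ 7 / 5040)) (fun x => by
      refine HasDerivAt.congr_deriv ((((((hasDerivAt_const x (1 : ℝ)).sub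
        ((hasDerivAt_pow 2 x).div_const 2)).add ((hasDerivAt_pow 4 x).div_const 24)).sub
        ((hasDerivAt_pow 6 x).div_const 720)).add ((hasDerivAt_pow 8 x).div_const 40320)).sub
        (hasDerivAt_cos x)) ?_
      push_cast; ring) (by simp) (fun x hx => by linarith [sin_ge_septic hx]) hx
  linarith

theorem sin_le_nonic {x : ℝ} (hx : 0 ≤ x) :
    sin x ≤ x - x ^ 3 / 6 + x ^ 5 / 120 - x ^ 7 / 5040 + x ^ 9 / 362880 := by
  have := nonneg_of_hasDerivAt_nonneg
    (f := fun x => x - x ^ 3 / 6 + x ^ 5 / 120 - x ^ 7 / 5040 + x ^ 9 / 362880 - sin x)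
    (f' := fun x => 1 - x ^ 2 / 2 + x ^ 4 / 24 - x ^ 6 / 720 + x ^ 8 / 40320 - cos x) (fun x => by
      refine HasDerivAt.congr_deriv ((((((hasDerivAt_id x).sub
        ((hasDerivAt_pow 3 x).div_const 6)).add ((hasDerivAt_pow 5 x).div_const 120)).sub
        ((hasDerivAt_pow 7 x).div_const 5040)).add ((hasDerivAt_pow 9 x).div_const 362880)).sub
        (hasDerivAt_sin x)) ?_
      push_cast; ring) (by simp) (fun x hx => by linarith [cos_le_octic hx]) hx
  linarith

/-! ### The absolute cardinal sine and its integral -/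

/-- The absolute value of the cardinal sine, away from the origin. -/
noncomputable def absSinc (t : ℝ) : ℝ := |sin t / t|

theorem absSinc_nonneg (t : ℝ) : 0 ≤ absSinc t := abs_nonneg _

theorem absSinc_eq {t : ℝ} (ht : 0 < t) : absSinc t = |sin t| / t := by
  rw [absSinc, abs_div, abs_of_pos ht]

theorem absSinc_eq_of_le_pi {t : ℝ} (ht : 0 < t) (h : t ≤ π) : absSinc t = sin t / t := by
  rw [absSinc_eq ht, abs_of_nonneg (sin_nonneg_of_nonneg_of_le_pi ht.le h)]

theorem absSinc_le_one (t : ℝ) : absSinc t ≤ 1 := by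
  rw [absSinc, abs_div]
  exact div_le_one_of_le₀ abs_sin_le_abs (abs_nonneg t)

theorem absSinc_le_inv {t : ℝ} (ht : 0 < t) : absSinc t ≤ t⁻¹ := by
  rw [absSinc_eq ht, div_eq_mul_inv]
  exact mul_le_of_le_one_left (inv_nonneg.2 ht.le) (abs_sin_le_one t)

theorem measurable_absSinc : Measurable absSinc :=
  (measurable_sin.div measurable_id).abs

theorem absSinc_pos {t : ℝ} (ht : 0 < t) (h : t < π) : 0 < absSinc t := by
  rw [absSinc_eq_of_le_pi ht h.le]
  exact div_pos (sin_pos_of_pos_of_lt_pi ht h) ht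

theorem absSinc_ge {t : ℝ} (ht : 0 < t) (h : t ≤ π) :
    1 - t ^ 2 / 6 + t ^ 4 / 120 - t ^ 6 / 5040 ≤ absSinc t := by
  rw [absSinc_eq_of_le_pi ht h, le_div_iff₀ ht]
  linarith [sin_ge_septic ht.le]

theorem absSinc_le_quartic {t : ℝ} (ht : 0 < t) (h : t ≤ π) :
    absSinc t ≤ 1 - t ^ 2 / 6 + t ^ 4 / 120 := by
  rw [absSinc_eq_of_le_pi ht h, div_le_iff₀ ht]
  linarith [sin_le_quintic ht.le]

theorem absSinc_le_octic {t : ℝ} (ht : 0 < t) (h : t ≤ π) :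
    absSinc t ≤ 1 - t ^ 2 / 6 + t ^ 4 / 120 - t ^ 6 / 5040 + t ^ 8 / 362880 := by
  rw [absSinc_eq_of_le_pi ht h, div_le_iff₀ ht]
  linarith [sin_le_nonic ht.le]

/-- A Gaussian majorant for dominated convergence. Giving up half of the coefficient 1/6 absorbs the
quartic Taylor term as long as t² ≤ 10, which covers t ≤ π. -/
theorem absSinc_le_exp {t : ℝ} (ht : 0 < t) (h : t ≤ π) : absSinc t ≤ exp (-(t ^ 2 / 12)) := by
  have h2 : t ^ 2 ≤ 10 := by nlinarith [pi_lt_d2, pi_pos]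
  have h3 := absSinc_le_quartic ht h
  have h4 := add_one_le_exp (-(t ^ 2 / 12))
  nlinarith [sq_nonneg t]

theorem absSinc_rpow_le {p t : ℝ} (hp : 0 ≤ p) (ht : 0 < t) : absSinc t ^ p ≤ t ^ (-p) := by
  rw [rpow_neg ht.le, ← inv_rpow ht.le]
  exact rpow_le_rpow (absSinc_nonneg t) (absSinc_le_inv ht) hp

theorem absSinc_rpow_le_one {p : ℝ} (hp : 0 ≤ p) (t : ℝ) : absSinc t ^ p ≤ 1 :=
  rpow_le_one (absSinc_nonneg t) (absSinc_le_one t) hp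

theorem absSinc_rpow_nonneg (p t : ℝ) : 0 ≤ absSinc t ^ p := rpow_nonneg (absSinc_nonneg t) p

theorem integrableOn_absSinc_rpow {p : ℝ} (hp : 1 < p) :
    IntegrableOn (fun t => absSinc t ^ p) (Ioi 0) := by
  rw [← Ioc_union_Ioi_eq_Ioi (zero_le_one (α := ℝ)), integrableOn_union]
  have hm : Measurable fun t => absSinc t ^ p := measurable_absSinc.pow_const p
  constructor
  · refine Measure.integrableOn_of_bounded (M := 1) (by simp) hm.aestronglyMeasurable ?_
    refine ae_of_all _ fun t => ?_
    rw [norm_of_nonneg (absSinc_rpow_nonneg p t)]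
    exact absSinc_rpow_le_one (by linarith) t
  · refine Integrable.mono' (integrableOn_Ioi_rpow_of_lt (a := -p) (by linarith) zero_lt_one)
      hm.aestronglyMeasurable ?_
    refine (ae_restrict_iff' measurableSet_Ioi).2 (ae_of_all _ fun t ht => ?_)
    rw [norm_of_nonneg (absSinc_rpow_nonneg p t)]
    exact absSinc_rpow_le (by linarith) (zero_lt_one.trans ht)

/-- The integral of the `p`-th power of the absolute cardinal sine over the half line. -/
noncomputable def sincIntegral (p : ℝ) : ℝ := ∫ t in Ioi (0 : ℝ), absSinc t ^ p

theorem ballFunction_eq (p : ℝ) :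
    ballFunction p = √(p / 2) * (2 / π) * sincIntegral p := rfl

theorem sincIntegral_pos {p : ℝ} (hp : 1 < p) : 0 < sincIntegral p := by
  have hi := integrableOn_absSinc_rpow hp
  rw [sincIntegral, setIntegral_pos_iff_support_of_nonneg_ae
    (ae_of_all _ fun t => absSinc_rpow_nonneg p t) hi]
  refine lt_of_lt_of_le ?_ (measure_mono (s := Ioo 0 π) fun t ht => ⟨?_, ht.1⟩)
  · simp [pi_pos]
  · exact (rpow_pos_of_pos (absSinc_pos ht.1 ht.2) p).ne'

theorem ballFunction_pos {p : ℝ} (hp : 1 < p) : 0 < ballFunction p := by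
  rw [ballFunction_eq]
  have := sincIntegral_pos hp
  have : 0 < p := by linarith
  positivity

/-! ### Truncated series for logarithms and fractional powers -/

theorem neg_log_ge_quadratic {s : ℝ} (h0 : 0 < s) (h1 : s ≤ 1) :
    (1 - s) + (1 - s) ^ 2 / 2 ≤ -log s := by
  have hanti : AntitoneOn (fun x : ℝ => -log x - (1 - x) - (1 - x) ^ 2 / 2) (Ioi 0) := by
    have hd : ∀ x ∈ Ioi (0 : ℝ), HasDerivAt (fun x : ℝ => -log x - (1 - x) - (1 - x) ^ 2 / 2)
        (-x⁻¹ + 1 + (1 - x)) x := fun x hx => by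
      refine HasDerivAt.congr_deriv (((hasDerivAt_log (ne_of_gt hx)).neg.sub
        ((hasDerivAt_const x (1 : ℝ)).sub (hasDerivAt_id x))).sub
        ((((hasDerivAt_const x (1 : ℝ)).sub (hasDerivAt_id x)).pow 2).div_const 2)) ?_
      simp; ring
    apply antitoneOn_of_deriv_nonpos (convex_Ioi 0)
    · exact fun y hy => (hd y hy).continuousAt.continuousWithinAt
    · rw [interior_Ioi]
      exact fun y hy => (hd y hy).differentiableAt.differentiableWithinAt
    · rw [interior_Ioi]
      intro y hy
      rw [(hd y hy).deriv]
      have hy' : 0 < y := hy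
      have : y * y⁻¹ = 1 := mul_inv_cancel₀ hy'.ne'
      have : 0 < y⁻¹ := inv_pos.2 hy'
      nlinarith [mul_nonneg this.le (sq_nonneg (y - 1))]
  have := hanti (mem_Ioi.2 h0) (mem_Ioi.2 one_pos) h1
  simp at this
  linarith

/-- Insert the quadratic bound for -log s into e^x ≥ 1 + x + x²/2. With b = 1 - a it controls the
sign of a derivative in `rpow_le_cubic`. -/
theorem rpow_neg_ge_quadratic {s b : ℝ} (hb : 0 ≤ b) (h0 : 0 < s) (h1 : s ≤ 1) :
    1 + b * (1 - s) + b * (1 + b) / 2 * (1 - s) ^ 2 ≤ s ^ (-b) := by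
  rw [rpow_def_of_pos h0]
  have hl := mul_le_mul_of_nonneg_left (neg_log_ge_quadratic h0 h1) hb
  have hx : 0 ≤ b * ((1 - s) + (1 - s) ^ 2 / 2) := by
    have : 0 ≤ 1 - s := by linarith
    positivity
  have he := quadratic_le_exp_of_nonneg hx
  have hm : exp (b * ((1 - s) + (1 - s) ^ 2 / 2)) ≤ exp (log s * -b) :=
    exp_le_exp.2 (by linarith)
  have hs : 0 ≤ 1 - s := by linarith
  have : 0 ≤ b ^ 2 * ((1 - s) ^ 3 / 2 + (1 - s) ^ 4 / 8) := by positivity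
  nlinarith

/-- The binomial series of `s ^ a = (1 - (1 - s)) ^ a`, truncated after three terms. -/
theorem rpow_le_cubic {s a : ℝ} (ha0 : 0 < a) (ha1 : a ≤ 1) (h0 : 0 ≤ s) (h1 : s ≤ 1) :
    s ^ a ≤ 1 - a * (1 - s) - a * (1 - a) / 2 * (1 - s) ^ 2
      - a * (1 - a) * (2 - a) / 6 * (1 - s) ^ 3 := by
  rcases h0.eq_or_lt with rfl | h0
  · rw [zero_rpow ha0.ne']
    -- At s = 0 the right side equals (1-a)(2-a)(3-a)/6.
    have : 0 ≤ (1 - a) * (2 - a) * (3 - a) :=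
      mul_nonneg (mul_nonneg (by linarith) (by linarith)) (by linarith)
    nlinarith
  set F : ℝ → ℝ := fun s => 1 - a * (1 - s) - a * (1 - a) / 2 * (1 - s) ^ 2
      - a * (1 - a) * (2 - a) / 6 * (1 - s) ^ 3 - s ^ a with hF
  have hd : ∀ x ∈ Ioi (0 : ℝ), HasDerivAt F
      (a * (1 + (1 - a) * (1 - x) + (1 - a) * (2 - a) / 2 * (1 - x) ^ 2 - x ^ (a - 1))) x :=
    fun x hx => by
    have hu : HasDerivAt (fun x : ℝ => 1 - x) (-1) x := by
      simpa using (hasDerivAt_id x).const_sub 1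
    refine HasDerivAt.congr_deriv ((((((hasDerivAt_const x (1 : ℝ)).sub
      (hu.const_mul a))).sub ((hu.pow 2).const_mul _)).sub ((hu.pow 3).const_mul _)).sub
      (hasDerivAt_rpow_const (Or.inl (ne_of_gt hx)))) ?_
    push_cast; ring
  have hanti : AntitoneOn F (Ioc 0 1) := by
    apply antitoneOn_of_deriv_nonpos (convex_Ioc 0 1)
    · exact fun y hy => (hd y hy.1).continuousAt.continuousWithinAt
    · rw [interior_Ioc]
      exact fun y hy => (hd y hy.1).differentiableAt.differentiableWithinAt
    · rw [interior_Ioc]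
      intro y hy
      rw [(hd y hy.1).deriv]
      have := rpow_neg_ge_quadratic (b := 1 - a) (by linarith) hy.1 hy.2.le
      rw [neg_sub] at this
      exact mul_nonpos_of_nonneg_of_nonpos ha0.le (by linarith)
  have := hanti ⟨h0, h1⟩ ⟨one_pos, le_rfl⟩ h1
  simp [hF] at this
  linarith

/-! ### Oscillating and averaged tail integrals -/

section CosineTail

variable {w w₁ w₂ : ℝ → ℝ} {ω : ℝ}

/-- Two integrations by parts. Since ωπ is a multiple of 2π, the boundary terms reduce to -w'(π)/ω²,
and the remaining integral of cos(ωt) w'' is at most ∫ w'' = -w'(π) in absolute value because w is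
convex. Hence the sign and the factor 2. -/
theorem integral_cos_mul_tail (hw : ∀ t, π ≤ t → HasDerivAt w (w₁ t) t)
    (hw₁ : ∀ t, π ≤ t → HasDerivAt w₁ (w₂ t) t) (hw₂ : ∀ t, π ≤ t → 0 ≤ w₂ t)
    (hlim : Tendsto w atTop (𝓝 0)) (hlim₁ : Tendsto w₁ atTop (𝓝 0))
    (hint : IntegrableOn w (Ioi π)) (hω : 0 < ω) (hsin : sin (ω * π) = 0)
    (hcos : cos (ω * π) = 1) :
    0 ≤ ∫ t in Ioi π, cos (ω * t) * w t ∧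
      ∫ t in Ioi π, cos (ω * t) * w t ≤ -(2 * w₁ π) / ω ^ 2 := by
  have hi₂ : IntegrableOn w₂ (Ioi π) := integrableOn_Ioi_deriv_of_nonneg
    (hw₁ π le_rfl).continuousAt.continuousWithinAt (fun t ht => hw₁ t (le_of_lt ht))
    (fun t ht => hw₂ t (le_of_lt ht)) hlim₁
  have hI₂ : ∫ t in Ioi π, w₂ t = -w₁ π := by
    rw [integral_Ioi_of_hasDerivAt_of_tendsto
      (hw₁ π le_rfl).continuousAt.continuousWithinAt (fun t ht => hw₁ t (le_of_lt ht)) hi₂ hlim₁,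
      zero_sub]
  have hcm : AEStronglyMeasurable (fun t => cos (ω * t)) (volume.restrict (Ioi π)) :=
    (by fun_prop : Measurable fun t => cos (ω * t)).aestronglyMeasurable
  have hcb : ∀ᵐ t ∂volume.restrict (Ioi π), ‖cos (ω * t)‖ ≤ 1 :=
    ae_of_all _ fun t => abs_cos_le_one _
  have hiw : IntegrableOn (fun t => cos (ω * t) * w t) (Ioi π) := Integrable.bdd_mul hint hcm hcb
  have hiw₂ : IntegrableOn (fun t => cos (ω * t) * w₂ t) (Ioi π) := Integrable.bdd_mul hi₂ hcm hcb
  have hlin : ∀ t : ℝ, HasDerivAt (fun t => ω * t) ω t := fun t => by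
    simpa using (hasDerivAt_id t).const_mul ω
  have hG : ∀ t, π ≤ t → HasDerivAt
      (fun t => sin (ω * t) * w t / ω + cos (ω * t) * w₁ t / ω ^ 2)
      (cos (ω * t) * w t + cos (ω * t) * w₂ t / ω ^ 2) t := fun t ht => by
    refine HasDerivAt.congr_deriv ((((hlin t).sin.mul (hw t ht)).div_const ω).add
      (((hlin t).cos.mul (hw₁ t ht)).div_const (ω ^ 2))) ?_
    field_simp
    ring
  have hbdd : ∀ {f g : ℝ → ℝ}, (∀ t, |f t| ≤ 1) → Tendsto g atTop (𝓝 0) →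
      Tendsto (fun t => f t * g t) atTop (𝓝 0) := fun {f g} hf hg => by
    refine squeeze_zero_norm (fun t => ?_) (tendsto_norm_zero.comp hg)
    rw [norm_mul, Real.norm_eq_abs (f t)]
    exact mul_le_of_le_one_left (norm_nonneg _) (hf t)
  have hGlim : Tendsto (fun t => sin (ω * t) * w t / ω + cos (ω * t) * w₁ t / ω ^ 2) atTop
      (𝓝 0) := by
    simpa using ((hbdd (f := fun t => sin (ω * t)) (fun t => abs_sin_le_one _) hlim).div_const
      ω).add ((hbdd (f := fun t => cos (ω * t)) (fun t => abs_cos_le_one _) hlim₁).div_const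
      (ω ^ 2))
  have hFTC := integral_Ioi_of_hasDerivAt_of_tendsto
    (hG π le_rfl).continuousAt.continuousWithinAt (fun t ht => hG t (le_of_lt ht))
    (hiw.add (hiw₂.div_const _)) hGlim
  rw [integral_add hiw (hiw₂.div_const _), integral_div, hsin, hcos] at hFTC
  have habs : |∫ t in Ioi π, cos (ω * t) * w₂ t| ≤ -w₁ π := by
    rw [← hI₂]
    rw [← Real.norm_eq_abs]
    refine norm_integral_le_of_norm_le hi₂ ?_
    refine (ae_restrict_iff' measurableSet_Ioi).2 (ae_of_all _ fun t ht => ?_)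
    rw [norm_mul]
    have h2 := hw₂ t (le_of_lt ht)
    rw [norm_of_nonneg h2]
    exact mul_le_of_le_one_left h2 (abs_cos_le_one _)
  rw [abs_le] at habs
  have hω2 : 0 < ω ^ 2 := by positivity
  have key : ∫ t in Ioi π, cos (ω * t) * w t =
      (-w₁ π - ∫ t in Ioi π, cos (ω * t) * w₂ t) / ω ^ 2 := by
    rw [sub_div]
    linear_combination hFTC
  rw [key]
  constructor
  · exact div_nonneg (by linarith) hω2.le
  · gcongr
    linarith

end CosineTail

theorem integral_Ioi_rpow_neg {a c : ℝ} (ha : 1 < a) (hc : 0 < c) :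
    ∫ t in Ioi c, t ^ (-a) = c ^ (1 - a) / (a - 1) := by
  rw [integral_Ioi_rpow_of_lt (by linarith) hc, neg_div, ← div_neg]
  congr 1
  · congr 1; ring
  · ring

theorem integrableOn_Ioi_rpow_neg {a c : ℝ} (ha : 1 < a) (hc : 0 < c) :
    IntegrableOn (fun t : ℝ => t ^ (-a)) (Ioi c) :=
  integrableOn_Ioi_rpow_of_lt (by linarith) hc

theorem integral_cos_mul_rpow_tail {a ω : ℝ} (ha : 1 < a) (hω : 0 < ω) (hsin : sin (ω * π) = 0)
    (hcos : cos (ω * π) = 1) :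
    0 ≤ ∫ t in Ioi π, cos (ω * t) * t ^ (-a) ∧
      ∫ t in Ioi π, cos (ω * t) * t ^ (-a) ≤ 2 * a * π ^ (-a - 1) / ω ^ 2 := by
  have h := integral_cos_mul_tail (w := fun t => t ^ (-a)) (w₁ := fun t => -a * t ^ (-a - 1))
    (w₂ := fun t => a * (a + 1) * t ^ (-a - 2)) (ω := ω)
    (fun t ht => hasDerivAt_rpow_const (Or.inl (pi_pos.trans_le ht).ne'))
    (fun t ht => by
      refine ((hasDerivAt_rpow_const (Or.inl (pi_pos.trans_le ht).ne')).const_mul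
        (-a)).congr_deriv ?_
      rw [show -a - 1 - 1 = -a - 2 by ring]; ring)
    (fun t ht => by
      have := pi_pos.trans_le ht
      positivity)
    (tendsto_rpow_neg_atTop (by linarith))
    (by
      have := (tendsto_rpow_neg_atTop (y := a + 1) (by linarith)).const_mul (-a)
      simpa [neg_add, sub_eq_add_neg, add_comm] using this)
    (integrableOn_Ioi_rpow_neg ha pi_pos) hω hsin hcos
  refine ⟨h.1, h.2.trans (le_of_eq ?_)⟩
  ring

/-- The cosine tail for a difference of powers that is convex on `[π, ∞)`. -/
theorem integral_cos_mul_rpow_sub_tail {a b ω : ℝ} (ha : 1 < a) (hab : a < b)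
    (hconv : b * (b + 1) ≤ a * (a + 1) * π ^ (b - a)) (hω : 0 < ω) (hsin : sin (ω * π) = 0)
    (hcos : cos (ω * π) = 1) :
    0 ≤ ∫ t in Ioi π, cos (ω * t) * (t ^ (-a) - t ^ (-b)) ∧
      ∫ t in Ioi π, cos (ω * t) * (t ^ (-a) - t ^ (-b)) ≤
        2 * (a * π ^ (-a - 1) - b * π ^ (-b - 1)) / ω ^ 2 := by
  have hlim : ∀ {c : ℝ}, 1 < c → Tendsto (fun t : ℝ => -c * t ^ (-c - 1)) atTop (𝓝 0) := by
    intro c hc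
    have := (tendsto_rpow_neg_atTop (y := c + 1) (by linarith)).const_mul (-c)
    simpa [neg_add, sub_eq_add_neg, add_comm] using this
  have hder : ∀ {c t : ℝ}, π ≤ t →
      HasDerivAt (fun t : ℝ => -c * t ^ (-c - 1)) (c * (c + 1) * t ^ (-c - 2)) t := by
    intro c t ht
    refine ((hasDerivAt_rpow_const (Or.inl (pi_pos.trans_le ht).ne')).const_mul
        (-c)).congr_deriv ?_
    rw [show -c - 1 - 1 = -c - 2 by ring]; ring
  have h := integral_cos_mul_tail (w := fun t => t ^ (-a) - t ^ (-b))
    (w₁ := fun t => -a * t ^ (-a - 1) - -b * t ^ (-b - 1))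
    (w₂ := fun t => a * (a + 1) * t ^ (-a - 2) - b * (b + 1) * t ^ (-b - 2)) (ω := ω)
    (fun t ht => (hasDerivAt_rpow_const (Or.inl (pi_pos.trans_le ht).ne')).sub
      (hasDerivAt_rpow_const (Or.inl (pi_pos.trans_le ht).ne')))
    (fun t ht => (hder ht).sub (hder ht))
    (fun t ht => by
      have ht0 := pi_pos.trans_le ht
      -- The ratio of the two terms of the second derivative grows like t^(b-a), so convexity at π
      -- implies convexity beyond.
      have hmono : π ^ (b - a) ≤ t ^ (b - a) := rpow_le_rpow pi_pos.le ht (by linarith)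
      have hsplit : t ^ (-a - 2) = t ^ (b - a) * t ^ (-b - 2) := by
        rw [← rpow_add ht0]; congr 1; ring
      have hpos : 0 < t ^ (-b - 2) := rpow_pos_of_pos ht0 _
      rw [hsplit, ← mul_assoc, ← sub_mul]
      refine mul_nonneg (sub_nonneg.2 (hconv.trans ?_)) hpos.le
      gcongr)
    (by
      simpa using (tendsto_rpow_neg_atTop (y := a) (by linarith)).sub
        (tendsto_rpow_neg_atTop (y := b) (by linarith)))
    (by simpa using (hlim ha).sub (hlim (ha.trans hab)))
    ((integrableOn_Ioi_rpow_neg ha pi_pos).sub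
      (integrableOn_Ioi_rpow_neg (ha.trans hab) pi_pos)) hω hsin hcos
  refine ⟨h.1, h.2.trans (le_of_eq ?_)⟩
  ring

theorem sin_four_pi : sin (4 * π) = 0 := by
  rw [show (4 : ℝ) * π = (4 : ℕ) * π by norm_num]; exact sin_nat_mul_pi 4

theorem cos_four_pi : cos (4 * π) = 1 := by
  rw [show (4 : ℝ) * π = (2 : ℕ) * (2 * π) by push_cast; ring]; exact cos_nat_mul_two_pi 2

theorem sin_six_pi : sin (6 * π) = 0 := by
  rw [show (6 : ℝ) * π = (6 : ℕ) * π by norm_num]; exact sin_nat_mul_pi 6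

theorem cos_six_pi : cos (6 * π) = 1 := by
  rw [show (6 : ℝ) * π = (3 : ℕ) * (2 * π) by push_cast; ring]; exact cos_nat_mul_two_pi 3

/-- Averaging over a quarter period: `|sin| ^ (9 / 4)` has mean at least `9 / 20`. -/
theorem integral_sin_rpow_mul_tail_ge {w : ℝ → ℝ} {T : ℝ} (hw : AntitoneOn w (Ioi T))
    (hpos : ∀ t, T < t → 0 ≤ w t) (hint : IntegrableOn w (Ioi T)) :
    9 / 20 * ∫ t in Ioi (T + π / 2), w t ≤ ∫ t in Ioi T, |sin t| ^ (9 / 4 : ℝ) * w t := by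
  have hpi := pi_pos
  have hsub : Ioi (T + π / 2) ⊆ Ioi T := Ioi_subset_Ioi (by linarith)
  have hb : ∀ {f w : ℝ → ℝ} {S : Set ℝ}, Measurable f → (∀ t, |f t| ≤ 1) → IntegrableOn w S →
      IntegrableOn (fun t => |f t| ^ (9 / 4 : ℝ) * w t) S := by
    intro f w S hf hf1 hS
    refine Integrable.bdd_mul (c := 1) hS (hf.abs.pow_const _).aestronglyMeasurable
      (ae_of_all _ fun t => ?_)
    rw [norm_of_nonneg (rpow_nonneg (abs_nonneg _) _)]
    exact rpow_le_one (abs_nonneg _) (hf1 t) (by norm_num)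
  -- Twice the integral is bounded below: one copy loses its first quarter period, the other is
  -- shifted by a quarter period, turning sine into cosine while the weight decreases.
  have h1 : ∫ t in Ioi (T + π / 2), |sin t| ^ (9 / 4 : ℝ) * w t ≤
      ∫ t in Ioi T, |sin t| ^ (9 / 4 : ℝ) * w t := by
    refine setIntegral_mono_set (hb measurable_sin abs_sin_le_one hint) ?_
      (LE.le.eventuallyLE hsub)
    refine (ae_restrict_iff' measurableSet_Ioi).2 (ae_of_all _ fun t ht => ?_)
    exact mul_nonneg (rpow_nonneg (abs_nonneg _) _) (hpos t ht)
  have hmp := measurePreserving_add_right (volume : Measure ℝ) (π / 2)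
  have hme := measurableEmbedding_addRight (π / 2)
  have hpre : (fun t => t + π / 2) ⁻¹' Ioi (T + π / 2) = Ioi T := by simp
  have hwi : IntegrableOn (fun t => w (t + π / 2)) (Ioi T) := by
    have := (hmp.integrableOn_comp_preimage hme (f := w) (s := Ioi (T + π / 2))).2
      (hint.mono_set hsub)
    rwa [hpre] at this
  have h2 : ∫ t in Ioi (T + π / 2), |cos t| ^ (9 / 4 : ℝ) * w t ≤
      ∫ t in Ioi T, |sin t| ^ (9 / 4 : ℝ) * w t := by
    have hshift := hmp.setIntegral_preimage_emb hme (fun t => |cos t| ^ (9 / 4 : ℝ) * w t)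
      (Ioi (T + π / 2))
    rw [hpre] at hshift
    simp only [cos_add_pi_div_two, abs_neg] at hshift
    rw [← hshift]
    refine setIntegral_mono_on (hb measurable_sin abs_sin_le_one hwi)
      (hb measurable_sin abs_sin_le_one hint) measurableSet_Ioi fun t ht => ?_
    refine mul_le_mul_of_nonneg_left (hw ht ?_ (by linarith)) (rpow_nonneg (abs_nonneg _) _)
    exact mem_Ioi.2 (by linarith [mem_Ioi.1 ht])
  have hmean : ∀ t, 9 / 10 ≤ |sin t| ^ (9 / 4 : ℝ) + |cos t| ^ (9 / 4 : ℝ) := by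
    have hsq : ∀ x : ℝ, |x| ^ (9 / 4 : ℝ) = (x ^ 2) ^ (9 / 8 : ℝ) := fun x => by
      rw [← sq_abs, ← rpow_natCast, ← rpow_mul (abs_nonneg _)]; norm_num
    -- The tangent to y^(9/8) at y = 1/2, where sin² = cos², with 2^(9/8) rounded up to 20/9. Adding
    -- it at y = sin² and at y = cos² gives exactly 9/10.
    have hb : ∀ y : ℝ, 0 ≤ y → 9 / 10 * (9 / 8 * y - 1 / 16) ≤ y ^ (9 / 8 : ℝ) := fun y hy => by
      have hB := one_add_mul_self_le_rpow_one_add (s := 2 * y - 1) (by linarith)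
        (p := 9 / 8) (by norm_num)
      rw [show 1 + (2 * y - 1) = 2 * y by ring, mul_rpow two_pos.le hy] at hB
      have h2 : (2 : ℝ) ^ (9 / 8 : ℝ) ≤ 20 / 9 := by
        rw [show (20 / 9 : ℝ) = ((20 / 9) ^ 8) ^ (1 / 8 : ℝ) by
          rw [← rpow_natCast, ← rpow_mul (by norm_num)]; norm_num,
          show (2 : ℝ) ^ (9 / 8 : ℝ) = (2 ^ 9) ^ (1 / 8 : ℝ) by
          rw [← rpow_natCast, ← rpow_mul (by norm_num)]; norm_num]
        exact rpow_le_rpow (by norm_num) (by norm_num) (by norm_num)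
      have := mul_le_mul_of_nonneg_right h2 (rpow_nonneg hy (9 / 8))
      linarith
    intro t
    rw [hsq, hsq]
    have h1 := hb _ (sq_nonneg (sin t))
    have h2 := hb _ (sq_nonneg (cos t))
    nlinarith [sin_sq_add_cos_sq t]
  have hint' := hint.mono_set hsub
  have h3 : ∫ t in Ioi (T + π / 2), 9 / 10 * w t ≤ ∫ t in Ioi (T + π / 2),
      (|sin t| ^ (9 / 4 : ℝ) * w t + |cos t| ^ (9 / 4 : ℝ) * w t) := by
    refine setIntegral_mono_on (hint'.const_mul _) ((hb measurable_sin abs_sin_le_one hint').add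
      (hb measurable_cos abs_cos_le_one hint')) measurableSet_Ioi fun t ht => ?_
    rw [← add_mul]
    exact mul_le_mul_of_nonneg_right (hmean t) (hpos t (hsub ht))
  rw [integral_const_mul, integral_add (hb measurable_sin abs_sin_le_one hint')
    (hb measurable_cos abs_cos_le_one hint')] at h3
  linarith

/-! ### The exact value at p = 2 -/

theorem integral_sin_sq_mul_exp {u : ℝ} (hu : 0 < u) :
    IntegrableOn (fun t => sin t ^ 2 * exp (-(u * t))) (Ioi 0) ∧
      ∫ t in Ioi (0 : ℝ), sin t ^ 2 * exp (-(u * t)) = 2 / (u * (u ^ 2 + 4)) := by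
  have hu4 : u ^ 2 + 4 ≠ 0 := by positivity
  set A : ℝ → ℝ := fun t => exp (-(u * t)) *
    (1 / 2 * (-(1 / u) - (2 * sin (2 * t) - u * cos (2 * t)) / (u ^ 2 + 4))) with hA
  have hlin : ∀ c t : ℝ, HasDerivAt (fun t => c * t) c t := fun c t => by
    simpa using (hasDerivAt_id t).const_mul c
  have hd : ∀ t, HasDerivAt A (sin t ^ 2 * exp (-(u * t))) t := fun t => by
    refine HasDerivAt.congr_deriv ((hlin u t).neg.exp.mul
      (((((hlin 2 t).sin.const_mul 2).sub ((hlin 2 t).cos.const_mul u)).div_const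
        (u ^ 2 + 4)).const_sub (-(1 / u)) |>.const_mul (1 / 2))) ?_
    have h2 : cos (2 * t) = 1 - 2 * sin t ^ 2 := by rw [cos_two_mul, cos_sq']; ring
    rw [h2]
    simp only [Pi.neg_apply]
    field_simp
    ring
  have hlim : Tendsto A atTop (𝓝 0) := by
    have hexp : Tendsto (fun t => exp (-(u * t))) atTop (𝓝 0) :=
      tendsto_exp_neg_atTop_nhds_zero.comp (tendsto_id.const_mul_atTop hu)
    refine squeeze_zero_norm (a := fun t => exp (-(u * t)) * (1 / u + (2 + u) / (u ^ 2 + 4)))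
      (fun t => ?_) (by simpa using hexp.mul_const (1 / u + (2 + u) / (u ^ 2 + 4)))
    rw [norm_mul, norm_of_nonneg (exp_pos _).le]
    refine mul_le_mul_of_nonneg_left ?_ (exp_pos _).le
    have hs := abs_le.1 (abs_sin_le_one (2 * t))
    have hc := abs_le.1 (abs_cos_le_one (2 * t))
    have hB : |(2 * sin (2 * t) - u * cos (2 * t)) / (u ^ 2 + 4)| ≤ (2 + u) / (u ^ 2 + 4) := by
      rw [abs_div, abs_of_pos (by positivity : 0 < u ^ 2 + 4)]
      gcongr
      rw [abs_le]
      constructor <;> nlinarith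
    have hu' : 0 < 1 / u := by positivity
    rw [abs_le] at hB
    rw [Real.norm_eq_abs, abs_le]
    constructor <;> linarith [hB.1, hB.2]
  have hi : IntegrableOn (fun t => sin t ^ 2 * exp (-(u * t))) (Ioi 0) :=
    integrableOn_Ioi_deriv_of_nonneg (hd 0).continuousAt.continuousWithinAt
      (fun t _ => hd t) (fun t _ => by positivity) hlim
  refine ⟨hi, ?_⟩
  rw [integral_Ioi_of_hasDerivAt_of_tendsto (hd 0).continuousAt.continuousWithinAt
    (fun t _ => hd t) hi hlim]
  simp [hA]
  field_simp
  ring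

theorem integral_two_div_sq_add_four :
    IntegrableOn (fun u : ℝ => 2 / (u ^ 2 + 4)) (Ioi 0) ∧
      ∫ u in Ioi (0 : ℝ), 2 / (u ^ 2 + 4) = π / 2 := by
  have hd : ∀ u : ℝ, HasDerivAt (fun u => arctan (u / 2)) (2 / (u ^ 2 + 4)) u := fun u => by
    refine HasDerivAt.congr_deriv ((hasDerivAt_id u).div_const 2).arctan ?_
    simp only [id]
    field_simp
    ring
  have hlim : Tendsto (fun u : ℝ => arctan (u / 2)) atTop (𝓝 (π / 2)) :=
    (tendsto_arctan_atTop.mono_right nhdsWithin_le_nhds).comp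
      (tendsto_id.atTop_div_const two_pos)
  have hi : IntegrableOn (fun u : ℝ => 2 / (u ^ 2 + 4)) (Ioi 0) :=
    integrableOn_Ioi_deriv_of_nonneg (hd 0).continuousAt.continuousWithinAt
      (fun t _ => hd t) (fun t _ => by positivity) hlim
  refine ⟨hi, ?_⟩
  rw [integral_Ioi_of_hasDerivAt_of_tendsto (hd 0).continuousAt.continuousWithinAt
    (fun t _ => hd t) hi hlim]
  simp

theorem integral_mul_exp_neg_mul {t : ℝ} (ht : 0 < t) :
    IntegrableOn (fun u => u * exp (-(u * t))) (Ioi 0) ∧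
      ∫ u in Ioi (0 : ℝ), u * exp (-(u * t)) = (t ^ 2)⁻¹ := by
  have h := integral_rpow_mul_exp_neg_mul_Ioi (a := 2) two_pos ht
  have hcongr : ∫ u in Ioi (0 : ℝ), u * exp (-(u * t)) = (t ^ 2)⁻¹ := by
    rw [Gamma_two, mul_one, show (2 : ℝ) - 1 = 1 by norm_num] at h
    simp only [rpow_one, rpow_two] at h
    rw [one_div, inv_pow] at h
    rw [← h]
    simp only [mul_comm t]
  refine ⟨?_, hcongr⟩
  exact Integrable.of_integral_ne_zero (by rw [hcongr]; positivity)

theorem absSinc_sq {t : ℝ} : absSinc t ^ (2 : ℝ) = sin t ^ 2 * (t ^ 2)⁻¹ := by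
  rw [rpow_two, absSinc, sq_abs, div_pow, div_eq_mul_inv]

/-- Write 1/t² as the integral of u e^{-ut} over u and exchange the integrals by Tonelli: the inner
one is the Laplace transform of sin², the outer one an arctangent. -/
theorem sincIntegral_two : sincIntegral 2 = π / 2 := by
  have hcalc : ∫⁻ t in Ioi (0 : ℝ), ENNReal.ofReal (absSinc t ^ (2 : ℝ)) =
      ENNReal.ofReal (π / 2) := by
    calc ∫⁻ t in Ioi (0 : ℝ), ENNReal.ofReal (absSinc t ^ (2 : ℝ))
        = ∫⁻ t in Ioi (0 : ℝ), ∫⁻ u in Ioi (0 : ℝ),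
            ENNReal.ofReal (sin t ^ 2 * (u * exp (-(u * t)))) := by
          refine setLIntegral_congr_fun measurableSet_Ioi fun t ht => ?_
          have h := integral_mul_exp_neg_mul ht
          rw [absSinc_sq, ← h.2, ← integral_const_mul,
            ofReal_integral_eq_lintegral_ofReal (h.1.const_mul _)]
          refine (ae_restrict_iff' measurableSet_Ioi).2 (ae_of_all _ fun u hu => ?_)
          have : (0 : ℝ) < u := hu
          show 0 ≤ _
          positivity
      _ = ∫⁻ u in Ioi (0 : ℝ), ∫⁻ t in Ioi (0 : ℝ),
            ENNReal.ofReal (sin t ^ 2 * (u * exp (-(u * t)))) := by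
          refine lintegral_lintegral_swap ?_
          refine Measurable.aemeasurable ?_
          fun_prop
      _ = ∫⁻ u in Ioi (0 : ℝ), ENNReal.ofReal (2 / (u ^ 2 + 4)) := by
          refine setLIntegral_congr_fun measurableSet_Ioi fun u hu => ?_
          have hu0 : (0 : ℝ) < u := hu
          have h := integral_sin_sq_mul_exp hu0
          have heq : 2 / (u ^ 2 + 4) = ∫ t in Ioi (0 : ℝ), sin t ^ 2 * (u * exp (-(u * t))) := by
            have : ∀ t : ℝ, sin t ^ 2 * (u * exp (-(u * t))) =
              u * (sin t ^ 2 * exp (-(u * t))) := fun t => by ring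
            simp only [this]
            rw [integral_const_mul, h.2]
            field_simp
          rw [heq, ofReal_integral_eq_lintegral_ofReal]
          · exact (h.1.const_mul u).congr (ae_of_all _ fun t => by simp only; ring)
          · exact ae_of_all _ fun t => by show 0 ≤ _; positivity
      _ = ENNReal.ofReal (π / 2) := by
          rw [← integral_two_div_sq_add_four.2,
            ofReal_integral_eq_lintegral_ofReal integral_two_div_sq_add_four.1]
          exact ae_of_all _ fun t => by show 0 ≤ _; positivity
  rw [sincIntegral, integral_eq_lintegral_of_nonneg_ae
    (ae_of_all _ fun t => absSinc_rpow_nonneg 2 t)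
    (measurable_absSinc.pow_const _).aestronglyMeasurable, hcalc,
    ENNReal.toReal_ofReal (by positivity)]

/-! ### Exact integration of even polynomials, and rational bounds for powers -/

/-- The even polynomial with coefficient list `l`. -/
def evenPoly : List ℝ → ℝ → ℝ
  | [], _ => 0
  | a :: l, x => a + x ^ 2 * evenPoly l x

/-- The antiderivative of `x ^ (2 * k) * evenPoly l x` that vanishes at the origin. -/
noncomputable def evenPolyPrim : List ℝ → ℕ → ℝ → ℝ
  | [], _, _ => 0
  | a :: l, k, x => a * x ^ (2 * k + 1) / (2 * k + 1) + evenPolyPrim l (k + 1) x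

theorem hasDerivAt_evenPolyPrim (l : List ℝ) (k : ℕ) (x : ℝ) :
    HasDerivAt (evenPolyPrim l k) (x ^ (2 * k) * evenPoly l x) x := by
  induction l generalizing k with
  | nil =>
    rw [evenPoly, mul_zero]
    exact hasDerivAt_const x 0
  | cons a l ih =>
    refine HasDerivAt.congr_deriv ((((hasDerivAt_pow (2 * k + 1) x).const_mul a).div_const
      (2 * k + 1)).add (ih (k + 1))) ?_
    have : (2 * (k : ℝ) + 1) ≠ 0 := by positivity
    simp only [evenPoly]
    push_cast
    field_simp
    ring

theorem continuous_evenPoly (l : List ℝ) : Continuous (evenPoly l) := by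
  induction l with
  | nil => exact continuous_const
  | cons a l ih => exact continuous_const.add ((continuous_pow 2).mul ih)

theorem integral_evenPoly (l : List ℝ) {b : ℝ} (hb : 0 ≤ b) :
    ∫ x in Ioo 0 b, evenPoly l x = evenPolyPrim l 0 b := by
  rw [← integral_Ioc_eq_integral_Ioo, ← intervalIntegral.integral_of_le hb,
    intervalIntegral.integral_eq_sub_of_hasDerivAt
    (f := evenPolyPrim l 0) (fun x _ => by simpa using hasDerivAt_evenPolyPrim l 0 x)
    ((continuous_evenPoly l).intervalIntegrable _ _)]
  have : ∀ k, evenPolyPrim l k 0 = 0 := by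
    induction l with
    | nil => intro k; rfl
    | cons a l ih => intro k; simp [evenPolyPrim, ih]
  rw [this, sub_zero]

theorem integrableOn_evenPoly (l : List ℝ) (b : ℝ) : IntegrableOn (evenPoly l) (Ioo 0 b) :=
  ((continuous_evenPoly l).integrableOn_Icc).mono_set Ioo_subset_Icc_self

theorem absSinc_rpow_eq {t : ℝ} (ht : 0 < t) (p : ℝ) :
    absSinc t ^ p = |sin t| ^ p * t ^ (-p) := by
  rw [absSinc_eq ht, div_rpow (abs_nonneg _) ht.le, rpow_neg ht.le, div_eq_mul_inv]

theorem abs_rpow_eq_sq_rpow (x p : ℝ) : |x| ^ p = (x ^ 2) ^ (p / 2) := by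
  rw [← sq_abs, ← rpow_natCast, ← rpow_mul (abs_nonneg _)]
  congr 1
  push_cast
  ring

/-- For exponents in ℤ/4, taking fourth powers turns an estimate for a power of π into one about
integer powers, settled by decimal bounds. -/
theorem rpow_le_of_pow_four_le {x e c : ℝ} (hx : 0 < x) (hc : 0 ≤ c) (n : ℤ)
    (hn : e = n / 4) (h : x ^ n ≤ c ^ 4) : x ^ e ≤ c := by
  have h1 : x ^ e = (x ^ n) ^ (1 / 4 : ℝ) := by
    rw [← rpow_intCast, ← rpow_mul hx.le, hn]; congr 1; ring
  have h2 : c = (c ^ 4) ^ (1 / 4 : ℝ) := by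
    rw [← rpow_natCast, ← rpow_mul hc]; norm_num
  rw [h1, h2]
  exact rpow_le_rpow (zpow_nonneg hx.le _) h (by norm_num)

theorem le_rpow_of_pow_four_le {x e c : ℝ} (hx : 0 < x) (hc : 0 ≤ c) (n : ℤ)
    (hn : e = n / 4) (h : c ^ 4 ≤ x ^ n) : c ≤ x ^ e := by
  have h1 : x ^ e = (x ^ n) ^ (1 / 4 : ℝ) := by
    rw [← rpow_intCast, ← rpow_mul hx.le, hn]; congr 1; ring
  have h2 : c = (c ^ 4) ^ (1 / 4 : ℝ) := by
    rw [← rpow_natCast, ← rpow_mul hc]; norm_num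
  rw [h1, h2]
  exact rpow_le_rpow (by positivity) h (by norm_num)

/-! ### The value at 9/4 -/

/-- Coefficients of a minorant of `s ^ 2 - s ^ (9 / 4)`, `s = absSinc t`, on `(0, 3)`. -/
noncomputable def powDiffMinorant : List ℝ :=
  [0, 1/24, -77/5760, 49/34560, -17/1075200, -283/29030400, 29/27648000, -1367/24385536000,
    1721/975421440000, -31/975421440000, 1/3901685760000]

/-- This Taylor polynomial is already negative at π, which is why the polynomial minorants stop at
3. -/
theorem absSinc_minorant_nonneg {t : ℝ} (ht : 0 < t) (h : t < 3) :
    0 ≤ 1 - t ^ 2 / 6 + t ^ 4 / 120 - t ^ 6 / 5040 := by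
  have hz : t ^ 2 ≤ 9 := by nlinarith
  have h1 : t ^ 6 ≤ 9 * t ^ 4 := by nlinarith [sq_nonneg (t ^ 2)]
  nlinarith [sq_nonneg (t ^ 2 - 9)]

/-- Factor s² - s^(9/4) = s²(1 - s^(1/4)), expand s^(1/4) around s = 1 to second order, and replace
s and 1 - s by nonnegative Taylor minorants. -/
theorem powDiffMinorant_le {t : ℝ} (ht : 0 < t) (h : t < 3) :
    evenPoly powDiffMinorant t ≤ absSinc t ^ (2 : ℝ) - absSinc t ^ (9 / 4 : ℝ) := by
  have h3 : t ≤ π := by linarith [pi_gt_three]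
  have hs0 := absSinc_pos ht (by linarith [pi_gt_three])
  have hs1 := absSinc_le_one t
  have hlow := absSinc_ge ht h3
  have hup := absSinc_le_quartic ht h3
  have hl0 := absSinc_minorant_nonneg ht h
  set s := absSinc t
  have hcub := rpow_le_cubic (a := 1 / 4) (by norm_num) (by norm_num) hs0.le hs1
  have hsplit : s ^ (9 / 4 : ℝ) = s ^ 2 * s ^ (1 / 4 : ℝ) := by
    rw [← rpow_two, ← rpow_add hs0]; norm_num
  rw [hsplit, rpow_two]
  have hU0 : 0 ≤ t ^ 2 / 6 - t ^ 4 / 120 := by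
    have hz : t ^ 2 ≤ 9 := by nlinarith
    nlinarith [sq_nonneg t]
  have hU : t ^ 2 / 6 - t ^ 4 / 120 ≤ 1 - s := by linarith
  have hU2 := pow_le_pow_left₀ hU0 hU 2
  have hl2 := pow_le_pow_left₀ hl0 hlow 2
  have hcub' : (1 - s) / 4 + 3 / 32 * (1 - s) ^ 2 ≤ 1 - s ^ (1 / 4 : ℝ) := by
    have : 0 ≤ (1 - s) ^ 3 := pow_nonneg (by linarith) 3
    linarith
  calc evenPoly powDiffMinorant t
      = (1 - t ^ 2 / 6 + t ^ 4 / 120 - t ^ 6 / 5040) ^ 2 *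
        ((t ^ 2 / 6 - t ^ 4 / 120) / 4 + 3 / 32 * (t ^ 2 / 6 - t ^ 4 / 120) ^ 2) := by
        simp only [evenPoly, powDiffMinorant]; ring
    _ ≤ s ^ 2 * ((1 - s) / 4 + 3 / 32 * (1 - s) ^ 2) := by gcongr
    _ ≤ s ^ 2 * (1 - s ^ (1 / 4 : ℝ)) := by gcongr
    _ = _ := by ring

theorem powDiffMinorant_integral :
    633 / 10000 ≤ ∫ t in Ioo (0 : ℝ) 3, evenPoly powDiffMinorant t := by
  rw [integral_evenPoly _ (by norm_num)]
  norm_num [evenPolyPrim, powDiffMinorant]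

/-- With y = sin² t, Bernoulli gives y^(9/8) ≤ y(7/8 + y/8), so y - y^(9/8) ≥ y(1-y)/8 = (1 - cos
4t)/64; the rest is y = (1 - cos 2t)/2. -/
theorem absSinc_pow_diff_tail {t : ℝ} (ht : 0 < t) :
    1 / 2 * (t ^ (-2 : ℝ) - t ^ (-(9 / 4) : ℝ)) -
        1 / 2 * (cos (2 * t) * (t ^ (-2 : ℝ) - t ^ (-(9 / 4) : ℝ))) +
        1 / 64 * (t ^ (-(9 / 4) : ℝ) - cos (4 * t) * t ^ (-(9 / 4) : ℝ)) ≤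
      absSinc t ^ (2 : ℝ) - absSinc t ^ (9 / 4 : ℝ) := by
  rw [absSinc_rpow_eq ht, absSinc_rpow_eq ht, abs_rpow_eq_sq_rpow, abs_rpow_eq_sq_rpow]
  have h2 : cos (2 * t) = 1 - 2 * sin t ^ 2 := by rw [cos_two_mul, cos_sq']; ring
  have h4 : cos (4 * t) = 2 * (1 - 2 * sin t ^ 2) ^ 2 - 1 := by
    rw [show 4 * t = 2 * (2 * t) by ring, cos_two_mul, h2]
  rw [h2, h4]
  have hy0 : 0 ≤ sin t ^ 2 := sq_nonneg _
  have hy1 : sin t ^ 2 ≤ 1 := sin_sq_le_one t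
  set y := sin t ^ 2
  have hb : y ^ (9 / 4 / 2 : ℝ) ≤ y * (7 / 8 + y / 8) := by
    rcases hy0.eq_or_lt with h0 | h0
    · rw [← h0, zero_rpow (by norm_num)]; norm_num
    · have := rpow_one_add_le_one_add_mul_self (s := y - 1) (by linarith) (p := 1 / 8)
        (by norm_num) (by norm_num)
      rw [show (9 / 4 / 2 : ℝ) = 1 + 1 / 8 by norm_num, rpow_add h0, rpow_one]
      rw [show 1 + (y - 1) = y by ring] at this
      exact mul_le_mul_of_nonneg_left (by linarith) hy0
  have hp : 0 < t ^ (-(9 / 4) : ℝ) := rpow_pos_of_pos ht _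
  have := mul_le_mul_of_nonneg_right hb hp.le
  rw [show (2 / 2 : ℝ) = 1 by norm_num, rpow_one]
  linarith

theorem integral_absSinc_pow_diff_tail :
    636 / 10000 ≤ ∫ t in Ioi π, (absSinc t ^ (2 : ℝ) - absSinc t ^ (9 / 4 : ℝ)) := by
  have hpi := pi_pos
  have hsub : Ioi π ⊆ Ioi 0 := Ioi_subset_Ioi hpi.le
  have i2 := integrableOn_Ioi_rpow_neg (a := 2) (by norm_num) hpi
  have i9 := integrableOn_Ioi_rpow_neg (a := 9 / 4) (by norm_num) hpi
  have hcos : ∀ {f : ℝ → ℝ} (ω : ℝ), IntegrableOn f (Ioi π) →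
      IntegrableOn (fun t => cos (ω * t) * f t) (Ioi π) := fun ω hf =>
    Integrable.bdd_mul hf
      (by fun_prop : Measurable fun t => cos (ω * t)).aestronglyMeasurable
      (ae_of_all _ fun t => abs_cos_le_one _)
  have hmono := setIntegral_mono_on
    (((((i2.sub i9).const_mul (1 / 2)).sub ((hcos 2 (i2.sub i9)).const_mul (1 / 2))).add
      ((i9.sub (hcos 4 i9)).const_mul (1 / 64))))
    (((integrableOn_absSinc_rpow (p := 2) (by norm_num)).mono_set hsub).sub
      ((integrableOn_absSinc_rpow (p := 9 / 4) (by norm_num)).mono_set hsub)) measurableSet_Ioi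
    fun t ht => absSinc_pow_diff_tail (hsub ht)
  simp only [Pi.sub_apply, Pi.add_apply] at hmono
  refine le_trans ?_ hmono
  have e1 : ∫ t in Ioi π, 1 / 2 * (t ^ (-2 : ℝ) - t ^ (-(9 / 4) : ℝ)) =
      1 / 2 * (π ^ (1 - 2 : ℝ) / (2 - 1) - π ^ (1 - 9 / 4 : ℝ) / (9 / 4 - 1)) := by
    rw [integral_const_mul, integral_sub i2 i9, integral_Ioi_rpow_neg (by norm_num) hpi,
      integral_Ioi_rpow_neg (by norm_num) hpi]
  have e3 : ∫ t in Ioi π, 1 / 64 * (t ^ (-(9 / 4) : ℝ) - cos (4 * t) * t ^ (-(9 / 4) : ℝ)) =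
      1 / 64 * (π ^ (1 - 9 / 4 : ℝ) / (9 / 4 - 1) -
        ∫ t in Ioi π, cos (4 * t) * t ^ (-(9 / 4) : ℝ)) := by
    rw [integral_const_mul, integral_sub i9 (hcos 4 i9), integral_Ioi_rpow_neg (by norm_num) hpi]
  have hsplit := integral_add (μ := volume.restrict (Ioi π))
    (((i2.sub i9).const_mul (1 / 2)).sub ((hcos 2 (i2.sub i9)).const_mul (1 / 2)))
      ((i9.sub (hcos 4 i9)).const_mul (1 / 64))
  have hsplit2 := integral_sub (μ := volume.restrict (Ioi π))
    ((i2.sub i9).const_mul (1 / 2)) ((hcos 2 (i2.sub i9)).const_mul (1 / 2))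
  simp only [Pi.sub_apply] at hsplit hsplit2
  -- Both oscillating integrals enter with a minus sign, so their upper bounds are the ones needed.
  have h4 := (integral_cos_mul_rpow_tail (a := 9 / 4) (ω := 4) (by norm_num) (by norm_num)
    sin_four_pi cos_four_pi).2
  have h2 := (integral_cos_mul_rpow_sub_tail (a := 2) (b := 9 / 4) (ω := 2) (by norm_num)
    (by norm_num) (by
      have : (122 / 100 : ℝ) ≤ π ^ (9 / 4 - 2 : ℝ) :=
        le_rpow_of_pow_four_le hpi (by norm_num) 1 (by norm_num) (by
          rw [zpow_one]; linarith [pi_gt_three])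
      linarith) (by norm_num) sin_two_pi cos_two_pi).2
  have hpl := pi_gt_d6
  have hpu := pi_lt_d6
  have ha : π ^ (1 - 9 / 4 : ℝ) ≤ 2392 / 10000 := by
    refine rpow_le_of_pow_four_le hpi (by norm_num) (-5) (by norm_num) ?_
    rw [zpow_neg, zpow_ofNat]
    refine inv_le_of_inv_le₀ (by norm_num) ?_
    calc ((2392 / 10000 : ℝ) ^ 4)⁻¹ ≤ 3.141592 ^ 5 := by norm_num
      _ ≤ π ^ 5 := by gcongr
  have hb : 242 / 10000 ≤ π ^ (-(9 / 4) - 1 : ℝ) := by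
    refine le_rpow_of_pow_four_le hpi (by norm_num) (-13) (by norm_num) ?_
    rw [zpow_neg, zpow_ofNat]
    refine le_inv_of_le_inv₀ (by positivity) ?_
    calc π ^ 13 ≤ 3.141593 ^ 13 := by gcongr
      _ ≤ ((242 / 10000 : ℝ) ^ 4)⁻¹ := by norm_num
  have hc : π ^ (-2 - 1 : ℝ) ≤ 32252 / 1000000 := by
    rw [show (-2 - 1 : ℝ) = ((-3 : ℤ) : ℝ) by norm_num, rpow_intCast, zpow_neg, zpow_ofNat]
    refine inv_le_of_inv_le₀ (by norm_num) ?_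
    calc ((32252 / 1000000 : ℝ))⁻¹ ≤ 3.141592 ^ 3 := by norm_num
      _ ≤ π ^ 3 := by gcongr
  have hd : 318309 / 1000000 ≤ π ^ (1 - 2 : ℝ) := by
    rw [show (1 - 2 : ℝ) = -1 by norm_num, rpow_neg_one]
    refine le_inv_of_le_inv₀ hpi ?_
    refine hpu.le.trans ?_
    norm_num
  rw [hsplit, hsplit2, e1, e3, integral_const_mul]
  have hb4 : π ^ (-(9 / 4) - 1 : ℝ) ≤ 243 / 10000 := by
    refine rpow_le_of_pow_four_le hpi (by norm_num) (-13) (by norm_num) ?_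
    rw [zpow_neg, zpow_ofNat]
    refine inv_le_of_inv_le₀ (by norm_num) ?_
    calc ((243 / 10000 : ℝ) ^ 4)⁻¹ ≤ 3.141592 ^ 13 := by norm_num
      _ ≤ π ^ 13 := by gcongr
  clear hmono hsplit hsplit2 e1 e3
  generalize (∫ t in Ioi π, cos (4 * t) * t ^ (-(9 / 4) : ℝ)) = C₄ at *
  generalize (∫ t in Ioi π, cos (2 * t) * (t ^ (-2 : ℝ) - t ^ (-(9 / 4) : ℝ))) = C₂ at *
  generalize π ^ (1 - 9 / 4 : ℝ) = a at *
  generalize π ^ (-(9 / 4) - 1 : ℝ) = b at *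
  generalize π ^ (-2 - 1 : ℝ) = c at *
  generalize π ^ (1 - 2 : ℝ) = d at *
  norm_num at h2 h4 ⊢
  linarith

/-- The integrand of I(2) - I(9/4) is nonnegative, so the strip [3, π] may be dropped; the other two
pieces contribute 0.0633 + 0.0636. -/
theorem sincIntegral_nine_fourths_le : sincIntegral (9 / 4) ≤ π / 2 - 1269 / 10000 := by
  have i2 := integrableOn_absSinc_rpow (p := 2) (by norm_num)
  have i9 := integrableOn_absSinc_rpow (p := 9 / 4) (by norm_num)
  have hsub : Ioo 0 3 ∪ Ioi π ⊆ Ioi (0 : ℝ) :=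
    union_subset (fun t ht => ht.1) (Ioi_subset_Ioi pi_pos.le)
  have hdisj : Disjoint (Ioo 0 3) (Ioi π) := by
    rw [Set.disjoint_left]
    intro t ht ht'
    have := mem_Ioi.1 ht'
    linarith [ht.2, pi_gt_three]
  have hnn : ∀ t ∈ Ioi (0 : ℝ), 0 ≤ absSinc t ^ (2 : ℝ) - absSinc t ^ (9 / 4 : ℝ) :=
    fun t _ => by
      have : absSinc t ^ (9 / 4 : ℝ) ≤ absSinc t ^ (2 : ℝ) := by
        rcases (absSinc_nonneg t).eq_or_lt with h0 | h0
        · rw [← h0, zero_rpow (by norm_num), zero_rpow (by norm_num)]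
        · exact rpow_le_rpow_of_exponent_ge h0 (absSinc_le_one t) (by norm_num)
      linarith
  have h1 := setIntegral_mono_set (i2.sub i9)
    ((ae_restrict_iff' measurableSet_Ioi).2 (ae_of_all _ hnn)) (LE.le.eventuallyLE hsub)
  have hii := i2.sub i9
  rw [setIntegral_union hdisj measurableSet_Ioi (hii.mono_set fun t ht => ht.1)
    (hii.mono_set (Ioi_subset_Ioi pi_pos.le))] at h1
  have h2 := setIntegral_mono_on (integrableOn_evenPoly powDiffMinorant 3)
    (hii.mono_set fun t ht => ht.1) measurableSet_Ioo fun t ht => powDiffMinorant_le ht.1 ht.2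
  have h3 := powDiffMinorant_integral
  have h4 := integral_absSinc_pow_diff_tail
  have h5 := integral_sub i2 i9
  simp only [Pi.sub_apply] at h1 h2
  rw [h5] at h1
  have e2 := sincIntegral_two
  simp only [sincIntegral] at e2 ⊢
  linarith

theorem ballFunction_nine_fourths_lt : ballFunction (9 / 4) < √(3 / π) := by
  have hpi := pi_pos
  have hI := sincIntegral_nine_fourths_le
  have hI0 := sincIntegral_pos (p := 9 / 4) (by norm_num)
  rw [ballFunction_eq]
  refine lt_sqrt_of_sq_lt ?_
  rw [mul_pow, mul_pow, sq_sqrt (by norm_num), div_pow]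
  -- Squaring turns the claim into exactly this inequality.
  have hsq : sincIntegral (9 / 4) ^ 2 < 2 * π / 3 := by
    have : sincIntegral (9 / 4) ^ 2 ≤ (π / 2 - 1269 / 10000) ^ 2 := by gcongr
    nlinarith [pi_gt_d4, pi_lt_d4]
  have : 9 / 4 / 2 * (2 ^ 2 / π ^ 2) * sincIntegral (9 / 4) ^ 2 <
      9 / 4 / 2 * (2 ^ 2 / π ^ 2) * (2 * π / 3) := by gcongr
  refine this.trans_le (le_of_eq ?_)
  field_simp
  norm_num

/-! ### The value at √2 + 1/2 -/

/-- Coefficients of a majorant of `(s ^ (1 + a) - s ^ 2) / (1 - a)` on `(0, 157 / 50)`, where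
`s = absSinc t` and `a = 4571 / 5000`. -/
noncomputable def powDiffMajorant : List ℝ :=
  [0, 1/6, -1757/36000, 42317/7560000, -11141/43200000, -36329/5443200000,
    3506369/2286144000000, -429193/4572288000000, 360629/109734912000000, -377/5225472000000,
    121/125411328000000, -11/1755758592000000]

/-- Here a = 4571/5000, and the cubic bound for s^a leaves (1-a)(1-s) as a factor of s^a - s. The
constants 457/1000 and 165/1000 are a/2 and a(2-a)/6 rounded down. -/
theorem rpow_sub_sq_le {s : ℝ} (h0 : 0 < s) (h1 : s ≤ 1) :
    s ^ (9571 / 5000 : ℝ) - s ^ (2 : ℝ) ≤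
      429 / 5000 * (s * (1 - s) * (1 - 457 / 1000 * (1 - s) - 165 / 1000 * (1 - s) ^ 2)) := by
  have hcub := rpow_le_cubic (a := 4571 / 5000) (by norm_num) (by norm_num) h0.le h1
  rw [show (9571 / 5000 : ℝ) = 1 + 4571 / 5000 by norm_num, rpow_add h0, rpow_one, rpow_two]
  have hu : 0 ≤ 1 - s := by linarith
  have h2 : 0 ≤ s * (1 - s) ^ 2 := by positivity
  have h3 : 0 ≤ s * (1 - s) ^ 3 := by positivity
  nlinarith [mul_le_mul_of_nonneg_left hcub h0.le]

/-- The three factors of `rpow_sub_sq_le` are replaced by Taylor majorants separately. Positivity of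
a lower Taylor polynomial for s is not needed, so the range can extend almost to π. -/
theorem le_powDiffMajorant {t : ℝ} (ht : 0 < t) (h : t < 157 / 50) :
    absSinc t ^ (9571 / 5000 : ℝ) - absSinc t ^ (2 : ℝ) ≤
      429 / 5000 * evenPoly powDiffMajorant t := by
  have h3 : t ≤ π := by linarith [pi_gt_d2]
  have hs0 := absSinc_pos ht (by linarith [pi_gt_d2])
  have hs1 := absSinc_le_one t
  have hlow := absSinc_ge ht h3
  have hup := absSinc_le_quartic ht h3
  have hup8 := absSinc_le_octic ht h3
  refine (rpow_sub_sq_le hs0 hs1).trans (mul_le_mul_of_nonneg_left ?_ (by norm_num))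
  set s := absSinc t
  have hz : t ^ 2 ≤ 10 := by nlinarith
  have hU0 : 0 ≤ t ^ 2 / 6 - t ^ 4 / 120 := by nlinarith [sq_nonneg t]
  have hU : t ^ 2 / 6 - t ^ 4 / 120 ≤ 1 - s := by linarith
  have hU2 := pow_le_pow_left₀ hU0 hU 2
  have hu0 : 0 ≤ 1 - s := by linarith
  have hB0 : 0 ≤ 1 - 457 / 1000 * (1 - s) - 165 / 1000 * (1 - s) ^ 2 := by nlinarith
  have hS0 : 0 ≤ 1 - t ^ 2 / 6 + t ^ 4 / 120 - t ^ 6 / 5040 + t ^ 8 / 362880 := by linarith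
  have hV : 1 - s ≤ t ^ 2 / 6 - t ^ 4 / 120 + t ^ 6 / 5040 := by linarith
  calc s * (1 - s) * (1 - 457 / 1000 * (1 - s) - 165 / 1000 * (1 - s) ^ 2)
      ≤ (1 - t ^ 2 / 6 + t ^ 4 / 120 - t ^ 6 / 5040 + t ^ 8 / 362880) *
        (t ^ 2 / 6 - t ^ 4 / 120 + t ^ 6 / 5040) *
        (1 - 457 / 1000 * (t ^ 2 / 6 - t ^ 4 / 120)
          - 165 / 1000 * (t ^ 2 / 6 - t ^ 4 / 120) ^ 2) := by
        refine mul_le_mul (mul_le_mul hup8 hV hu0 hS0) (by linarith) hB0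
          (mul_nonneg hS0 (hu0.trans hV))
    _ = evenPoly powDiffMajorant t := by
        simp only [evenPoly, powDiffMajorant]; ring

theorem powDiffMajorant_integral :
    ∫ t in Ioo (0 : ℝ) (157 / 50), evenPoly powDiffMajorant t ≤ 3265 / 10000 := by
  rw [integral_evenPoly _ (by norm_num)]
  norm_num [evenPolyPrim, powDiffMajorant]

theorem absSinc_pow_diff_tail_le {t : ℝ} (ht : 0 < t) :
    absSinc t ^ (9571 / 5000 : ℝ) - absSinc t ^ (2 : ℝ) ≤
      1 / 2 * (t ^ (-(9571 / 5000) : ℝ) - t ^ (-2 : ℝ)) -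
        1 / 2 * (cos (2 * t) * (t ^ (-(9571 / 5000) : ℝ) - t ^ (-2 : ℝ))) +
        (463 / 40000 * t ^ (-(9571 / 5000) : ℝ) +
          1267 / 160000 * (cos (2 * t) * t ^ (-(9571 / 5000) : ℝ)) -
          31 / 8000 * (cos (4 * t) * t ^ (-(9571 / 5000) : ℝ)) -
          7 / 32000 * (cos (6 * t) * t ^ (-(9571 / 5000) : ℝ))) := by
  rw [absSinc_rpow_eq ht, absSinc_rpow_eq ht, abs_rpow_eq_sq_rpow, abs_rpow_eq_sq_rpow]
  have h2 : cos (2 * t) = 2 * (1 - sin t ^ 2) - 1 := by rw [cos_two_mul, cos_sq']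
  have h4 : cos (4 * t) = 2 * (2 * (1 - sin t ^ 2) - 1) ^ 2 - 1 := by
    rw [show 4 * t = 2 * (2 * t) by ring, cos_two_mul, h2]
  have h6 : cos (6 * t) = 4 * (2 * (1 - sin t ^ 2) - 1) ^ 3 - 3 * (2 * (1 - sin t ^ 2) - 1) := by
    rw [show 6 * t = 3 * (2 * t) by ring, cos_three_mul, h2]
  rw [h2, h4, h6]
  have hy0 : 0 ≤ sin t ^ 2 := sq_nonneg _
  have hy1 : sin t ^ 2 ≤ 1 := sin_sq_le_one t
  set y := sin t ^ 2
  -- The cubic bound with its last two coefficients rounded down; as a polynomial in 1 - y = cos² t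
  -- it has frequencies 2, 4 and 6.
  have hb : y ^ (9571 / 5000 / 2 : ℝ) ≤
      y + 429 / 10000 * (1 - y) - 205 / 10000 * (1 - y) ^ 2 - 7 / 1000 * (1 - y) ^ 3 := by
    have := rpow_le_cubic (a := 9571 / 5000 / 2) (by norm_num) (by norm_num) hy0 hy1
    have h2 : 0 ≤ (1 - y) ^ 2 := sq_nonneg _
    have h3 : 0 ≤ (1 - y) ^ 3 := pow_nonneg (by linarith) 3
    linarith
  have hp : 0 < t ^ (-(9571 / 5000) : ℝ) := rpow_pos_of_pos ht _
  have := mul_le_mul_of_nonneg_right hb hp.le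
  rw [show (2 / 2 : ℝ) = 1 by norm_num, rpow_one]
  refine (sub_le_sub_right this _).trans (le_of_eq ?_)
  ring

theorem pi_rpow_le : π ^ (1 - 9571 / 5000 : ℝ) ≤ 35137 / 100000 := by
  have hpi := pi_pos
  have h1 : π ^ (429 / 5000 : ℝ) ≤ 11038 / 10000 := by
    -- 5/58 lies just above 429/5000 and has a manageable denominator.
    have hmono : π ^ (429 / 5000 : ℝ) ≤ π ^ (5 / 58 : ℝ) :=
      rpow_le_rpow_of_exponent_le (by linarith [pi_gt_three]) (by norm_num)
    refine hmono.trans ?_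
    have e1 : π ^ (5 / 58 : ℝ) = (π ^ 5) ^ (1 / 58 : ℝ) := by
      rw [← rpow_natCast, ← rpow_mul hpi.le]; norm_num
    have e2 : (11038 / 10000 : ℝ) = ((11038 / 10000) ^ 58) ^ (1 / 58 : ℝ) := by
      rw [← rpow_natCast, ← rpow_mul (by norm_num)]; norm_num
    rw [e1, e2]
    refine rpow_le_rpow (by positivity) ?_ (by norm_num)
    calc π ^ 5 ≤ 3.141593 ^ 5 := by gcongr; exact pi_lt_d6.le
      _ ≤ (11038 / 10000) ^ 58 := by norm_num
  have h2 : π⁻¹ ≤ 31832 / 100000 :=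
    inv_le_of_inv_le₀ (by norm_num) (le_trans (by norm_num) pi_gt_d6.le)
  rw [show (1 - 9571 / 5000 : ℝ) = 429 / 5000 + -1 by norm_num, rpow_add hpi, rpow_neg_one]
  calc π ^ (429 / 5000 : ℝ) * π⁻¹ ≤ 11038 / 10000 * (31832 / 100000) := by gcongr
    _ ≤ _ := by norm_num

theorem integral_absSinc_pow_diff_tail_le :
    ∫ t in Ioi π, (absSinc t ^ (9571 / 5000 : ℝ) - absSinc t ^ (2 : ℝ)) ≤ 383 / 10000 := by
  have hpi := pi_pos
  have hsub : Ioi π ⊆ Ioi 0 := Ioi_subset_Ioi hpi.le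
  have i2 := integrableOn_Ioi_rpow_neg (a := 2) (by norm_num) hpi
  have ip := integrableOn_Ioi_rpow_neg (a := 9571 / 5000) (by norm_num) hpi
  have hcos : ∀ {f : ℝ → ℝ} (ω : ℝ), IntegrableOn f (Ioi π) →
      IntegrableOn (fun t => cos (ω * t) * f t) (Ioi π) := fun ω hf =>
    Integrable.bdd_mul hf
      (by fun_prop : Measurable fun t => cos (ω * t)).aestronglyMeasurable
      (ae_of_all _ fun t => abs_cos_le_one _)
  have ia := (ip.sub i2).const_mul (1 / 2)
  have ib := (hcos 2 (ip.sub i2)).const_mul (1 / 2)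
  have ic := ip.const_mul (463 / 40000)
  have id' := (hcos 2 ip).const_mul (1267 / 160000)
  have ie := (hcos 4 ip).const_mul (31 / 8000)
  have ig := (hcos 6 ip).const_mul (7 / 32000)
  have hmono := setIntegral_mono_on
    (((integrableOn_absSinc_rpow (p := 9571 / 5000) (by norm_num)).mono_set hsub).sub
      ((integrableOn_absSinc_rpow (p := 2) (by norm_num)).mono_set hsub))
    ((ia.sub ib).add (((ic.add id').sub ie).sub ig)) measurableSet_Ioi
    fun t ht => absSinc_pow_diff_tail_le (hsub ht)
  have e0 := integral_add (μ := volume.restrict (Ioi π)) (ia.sub ib) (((ic.add id').sub ie).sub ig)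
  have e1 := integral_sub (μ := volume.restrict (Ioi π)) ia ib
  have e2 := integral_sub (μ := volume.restrict (Ioi π)) ((ic.add id').sub ie) ig
  have e3 := integral_sub (μ := volume.restrict (Ioi π)) (ic.add id') ie
  have e4 := integral_add (μ := volume.restrict (Ioi π)) ic id'
  have e5 := integral_sub (μ := volume.restrict (Ioi π)) ip i2
  simp only [Pi.sub_apply, Pi.add_apply] at hmono e0 e1 e2 e3
  rw [e0, e1, e2, e3, e4] at hmono
  simp only [integral_const_mul] at hmono
  rw [e5, integral_Ioi_rpow_neg (by norm_num) hpi, integral_Ioi_rpow_neg (by norm_num) hpi]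
    at hmono
  have h2 := integral_cos_mul_rpow_tail (a := 9571 / 5000) (ω := 2) (by norm_num) (by norm_num)
    sin_two_pi cos_two_pi
  have h4 := integral_cos_mul_rpow_tail (a := 9571 / 5000) (ω := 4) (by norm_num) (by norm_num)
    sin_four_pi cos_four_pi
  have h6 := integral_cos_mul_rpow_tail (a := 9571 / 5000) (ω := 6) (by norm_num) (by norm_num)
    sin_six_pi cos_six_pi
  have hW := integral_cos_mul_rpow_sub_tail (a := 9571 / 5000) (b := 2) (ω := 2) (by norm_num)
    (by norm_num) (by
      have h12 : (10757 / 10000 : ℝ) ≤ π ^ (1 / 12 : ℝ) := by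
        have e2 : (10757 / 10000 : ℝ) = ((10757 / 10000) ^ 12) ^ (1 / 12 : ℝ) := by
          rw [← rpow_natCast, ← rpow_mul (by norm_num)]; norm_num
        rw [e2]
        exact rpow_le_rpow (by norm_num) (le_trans (by norm_num) pi_gt_three.le) (by norm_num)
      have : π ^ (1 / 12 : ℝ) ≤ π ^ (2 - 9571 / 5000 : ℝ) :=
        rpow_le_rpow_of_exponent_le (by linarith [pi_gt_three]) (by norm_num)
      linarith) (by norm_num) sin_two_pi cos_two_pi
  have hd : 318309 / 1000000 ≤ π ^ (1 - 2 : ℝ) := by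
    rw [show (1 - 2 : ℝ) = -1 by norm_num, rpow_neg_one]
    refine le_inv_of_le_inv₀ hpi ?_
    refine pi_lt_d6.le.trans ?_
    norm_num
  have hb : π ^ (-(9571 / 5000) - 1 : ℝ) ≤ 4 / 100 := by
    have : π ^ (-(9571 / 5000) - 1 : ℝ) ≤ π ^ (-(29 / 10) : ℝ) :=
      rpow_le_rpow_of_exponent_le (by linarith [pi_gt_three]) (by norm_num)
    refine this.trans ?_
    have e1 : π ^ (-(29 / 10) : ℝ) = ((π ^ 29)⁻¹) ^ (1 / 10 : ℝ) := by
      rw [← rpow_natCast, ← rpow_neg hpi.le, ← rpow_mul hpi.le]; norm_num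
    have e2 : (4 / 100 : ℝ) = ((4 / 100) ^ 10) ^ (1 / 10 : ℝ) := by
      rw [← rpow_natCast, ← rpow_mul (by norm_num)]; norm_num
    rw [e1, e2]
    refine rpow_le_rpow (by positivity) ?_ (by norm_num)
    refine inv_le_of_inv_le₀ (by norm_num) ?_
    calc ((4 / 100 : ℝ) ^ 10)⁻¹ ≤ 3.14 ^ 29 := by norm_num
      _ ≤ π ^ 29 := by gcongr; exact pi_gt_d2.le
  have ha := pi_rpow_le
  -- Only the separate cos 2t term has a positive coefficient and needs its upper bound; for the
  -- others nonnegativity suffices.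
  have h2' := h2.2
  have h4' := h4.1
  have h6' := h6.1
  have hW' := hW.1
  clear e0 e1 e2 e3 e4 e5 h2 h4 h6 hW
  generalize (∫ t in Ioi π, (absSinc t ^ (9571 / 5000 : ℝ) - absSinc t ^ (2 : ℝ))) = X at *
  generalize (∫ t in Ioi π, cos (6 * t) * t ^ (-(9571 / 5000) : ℝ)) = C₆ at *
  generalize (∫ t in Ioi π, cos (4 * t) * t ^ (-(9571 / 5000) : ℝ)) = C₄ at *
  generalize (∫ t in Ioi π, cos (2 * t) * t ^ (-(9571 / 5000) : ℝ)) = C₂ at *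
  generalize (∫ t in Ioi π, cos (2 * t) * (t ^ (-(9571 / 5000) : ℝ) - t ^ (-2 : ℝ))) = W at *
  generalize π ^ (1 - 9571 / 5000 : ℝ) = a at *
  generalize π ^ (-(9571 / 5000) - 1 : ℝ) = b at *
  generalize π ^ (1 - 2 : ℝ) = d at *
  norm_num at h2' hmono ⊢
  linarith

theorem sincIntegral_le : sincIntegral (9571 / 5000) ≤ π / 2 + 668 / 10000 := by
  have i2 := integrableOn_absSinc_rpow (p := 2) (by norm_num)
  have ip := integrableOn_absSinc_rpow (p := 9571 / 5000) (by norm_num)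
  have hii : IntegrableOn (fun t => absSinc t ^ (9571 / 5000 : ℝ) - absSinc t ^ (2 : ℝ)) (Ioi 0) :=
    ip.sub i2
  have hpi := pi_gt_d2
  have s1 : Ioi (0 : ℝ) = Ioo 0 (157 / 50) ∪ (Icc (157 / 50) π ∪ Ioi π) := by
    rw [Icc_union_Ioi_eq_Ici (by linarith), Ioo_union_Ici_eq_Ioi (by norm_num)]
  have d1 : Disjoint (Ioo (0 : ℝ) (157 / 50)) (Icc (157 / 50) π ∪ Ioi π) := by
    rw [Icc_union_Ioi_eq_Ici (by linarith), Set.disjoint_left]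
    intro t ht ht'
    exact absurd ht.2 (not_lt.2 ht')
  have d2 : Disjoint (Icc (157 / 50) π) (Ioi π) := by
    rw [Set.disjoint_left]
    intro t ht ht'
    exact absurd ht.2 (not_le.2 ht')
  have hsub1 : Ioo (0 : ℝ) (157 / 50) ⊆ Ioi 0 := fun t ht => ht.1
  have hsub2 : Icc (157 / 50) π ⊆ Ioi 0 := fun t ht => mem_Ioi.2 (by linarith [ht.1])
  have hsub3 : Ioi π ⊆ Ioi 0 := Ioi_subset_Ioi pi_pos.le
  have h1 := setIntegral_mono_on (hii.mono_set hsub1)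
    ((integrableOn_evenPoly powDiffMajorant (157 / 50)).const_mul (429 / 5000))
    measurableSet_Ioo fun t ht => le_powDiffMajorant ht.1 ht.2
  -- The interval [3.14, π] is shorter than 1/500, so a crude bound is enough.
  have h2 := setIntegral_mono_on (hii.mono_set hsub2)
    (g := fun _ => (1 / 10 : ℝ)) (by simp) measurableSet_Icc fun t ht => by
      have ht0 : 0 < t := hsub2 ht
      rcases (absSinc_nonneg t).eq_or_lt with h0 | h0
      · rw [← h0, zero_rpow (by norm_num), zero_rpow (by norm_num)]; norm_num
      · refine (rpow_sub_sq_le h0 (absSinc_le_one t)).trans ?_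
        have h1 := absSinc_le_one t
        have : 0 ≤ absSinc t * (1 - absSinc t) := mul_nonneg h0.le (by linarith)
        have h3 : 1 - 457 / 1000 * (1 - absSinc t) - 165 / 1000 * (1 - absSinc t) ^ 2 ≤ 1 := by
          nlinarith
        have h4 := mul_le_mul_of_nonneg_left h3 this
        nlinarith [sq_nonneg (absSinc t - 1 / 2)]
  have h3 := integral_absSinc_pow_diff_tail_le
  have h4 : ∫ t in Ioi (0 : ℝ), (absSinc t ^ (9571 / 5000 : ℝ) - absSinc t ^ (2 : ℝ)) ≤
      668 / 10000 := by
    rw [s1, setIntegral_union d1 (measurableSet_Icc.union measurableSet_Ioi) (hii.mono_set hsub1)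
      (hii.mono_set (union_subset hsub2 hsub3)), setIntegral_union d2 measurableSet_Ioi
      (hii.mono_set hsub2) (hii.mono_set hsub3)]
    rw [integral_const_mul] at h1
    have h5 := powDiffMajorant_integral
    rw [setIntegral_const, smul_eq_mul, measureReal_def, Real.volume_Icc,
      ENNReal.toReal_ofReal (by linarith)] at h2
    linarith [pi_lt_d4]
  rw [integral_sub ip i2] at h4
  have e2 := sincIntegral_two
  simp only [sincIntegral] at e2 ⊢
  linarith

theorem sincIntegral_antitone {p q : ℝ} (hp : 1 < p) (hpq : p ≤ q) :
    sincIntegral q ≤ sincIntegral p := by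
  refine setIntegral_mono_on (integrableOn_absSinc_rpow (hp.trans_le hpq))
    (integrableOn_absSinc_rpow hp) measurableSet_Ioi fun t _ => ?_
  rcases (absSinc_nonneg t).eq_or_lt with h0 | h0
  · rw [← h0, zero_rpow (by linarith), zero_rpow (by linarith)]
  · exact rpow_le_rpow_of_exponent_ge h0 (absSinc_le_one t) hpq

theorem sqrt_two_bounds : 14142 / 10000 ≤ √2 ∧ √2 ≤ 141422 / 100000 :=
  ⟨le_sqrt_of_sq_le (by norm_num), sqrt_le_iff.2 ⟨by norm_num, by norm_num⟩⟩

/-- The rational 9571/5000 = 1.9142 lies just below √2 + 1/2, and I is decreasing. -/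
theorem ballFunction_sqrt_two_add_half_lt : ballFunction (√2 + 1 / 2) < 51 / 50 := by
  obtain ⟨hl, hu⟩ := sqrt_two_bounds
  have hpi := pi_pos
  have hI := (sincIntegral_antitone (p := 9571 / 5000) (q := √2 + 1 / 2) (by norm_num)
    (by linarith)).trans sincIntegral_le
  have hI0 := sincIntegral_pos (p := √2 + 1 / 2) (by linarith)
  have hs : √((√2 + 1 / 2) / 2) ≤ 97832 / 100000 := by
    refine sqrt_le_iff.2 ⟨by norm_num, ?_⟩
    linarith
  rw [ballFunction_eq]
  calc √((√2 + 1 / 2) / 2) * (2 / π) * sincIntegral (√2 + 1 / 2)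
      ≤ 97832 / 100000 * (2 / π) * (π / 2 + 668 / 10000) := by gcongr
    _ < 51 / 50 := by
      have : 97832 / 100000 * (2 / π) * (π / 2 + 668 / 10000) =
        97832 / 100000 + 97832 / 100000 * (2 * 668 / 10000) / π := by field_simp
      rw [this]
      have h2 : 97832 / 100000 * (2 * 668 / 10000) / π < 51 / 50 - 97832 / 100000 := by
        rw [div_lt_iff₀ hpi]
        linarith [pi_gt_d4]
      linarith

/-! ### Convexity -/

/-- Up to the factor `p ^ (-3 / 2)`, the second derivative of `√p * exp (-p * l)` is
`curvature (p * l)`. -/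
noncomputable def curvature (x : ℝ) : ℝ := (x ^ 2 - x - 1 / 4) * exp (-x)

/-- After multiplication by e^x and e^x ≥ 1 + x + x²/2, a quadratic with negative discriminant
remains; its minimum is at 13/47. -/
theorem curvature_ge {x : ℝ} (hx : 0 ≤ x) : -(7 / 20) ≤ curvature x := by
  have h := quadratic_le_exp_of_nonneg hx
  have hE := exp_pos (-x)
  have h1 : exp x * exp (-x) = 1 := by rw [← exp_add]; simp
  have h2 : 0 ≤ x ^ 2 - x - 1 / 4 + 7 / 20 * exp x := by nlinarith [sq_nonneg (x - 13 / 47)]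
  have := mul_nonneg h2 hE.le
  rw [curvature]
  nlinarith

theorem curvature_nonneg {x : ℝ} (hx : 5 / 4 ≤ x) : 0 ≤ curvature x :=
  mul_nonneg (by nlinarith) (exp_pos _).le

/-- The derivative is (-x² + 3x - 3/4) e^{-x}, whose larger zero (3 + √6)/2 is just below 11/4. -/
theorem curvature_antitoneOn : AntitoneOn curvature (Ici (11 / 4)) := by
  have hd : ∀ x, HasDerivAt curvature ((-x ^ 2 + 3 * x - 3 / 4) * exp (-x)) x := fun x => by
    refine HasDerivAt.congr_deriv ((((hasDerivAt_pow 2 x).sub (hasDerivAt_id x)).sub_const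
      (1 / 4)).mul (hasDerivAt_neg x).exp) ?_
    simp only [Pi.sub_apply, id]
    push_cast
    ring
  apply antitoneOn_of_deriv_nonpos (convex_Ici _)
  · exact fun y _ => (hd y).continuousAt.continuousWithinAt
  · exact fun y _ => (hd y).differentiableAt.differentiableWithinAt
  · intro y hy
    rw [interior_Ici] at hy
    have : (11 / 4 : ℝ) < y := hy
    rw [(hd y).deriv]
    exact mul_nonpos_of_nonpos_of_nonneg (by nlinarith) (exp_pos _).le

/-- Explains the cutoff 9/2: beyond it p log t ≥ 1.914 · 3/2 > 11/4, so `curvature` is evaluated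
only where it decreases. -/
theorem three_halves_le_log {t : ℝ} (ht : 9 / 2 ≤ t) : 3 / 2 ≤ log t := by
  rw [le_log_iff_exp_le (by linarith)]
  refine le_trans ?_ ht
  have h1 : exp (3 / 2) ^ 2 = exp 1 ^ 3 := by
    rw [← exp_nat_mul, ← exp_nat_mul]; norm_num
  have h2 : exp 1 ^ 3 ≤ 2.7182818286 ^ 3 := by gcongr; exact exp_one_lt_d9.le
  refine le_of_sq_le_sq ?_ (by norm_num)
  rw [h1]
  refine h2.trans ?_
  norm_num

theorem exp_neg_mul_log {t : ℝ} (ht : 0 < t) (c : ℝ) : exp (-(c * log t)) = t ^ (-c) := by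
  rw [rpow_def_of_pos ht]; ring_nf

theorem tendsto_rpow_mul_quadratic_log (A B C : ℝ) (hA : 0 ≤ A) (hB : 0 ≤ B) (hC : 0 ≤ C) :
    Tendsto (fun t => -(t ^ (-(5 / 4) : ℝ) * (A * log t ^ 2 + B * log t + C))) atTop (𝓝 0) := by
  have hlim := (tendsto_rpow_neg_atTop (y := 1 / 4) (by norm_num)).mul_const (4 * A + 2 * B + C)
  rw [zero_mul] at hlim
  refine squeeze_zero_norm' ?_ hlim
  filter_upwards [eventually_ge_atTop 1] with t ht
  have ht0 : 0 < t := by linarith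
  have hl0 : 0 ≤ log t := log_nonneg ht
  have hl := log_le_rpow_div ht0.le (ε := 1 / 2) (by norm_num)
  have hr : (t ^ (1 / 2 : ℝ)) ^ 2 = t := by
    rw [← rpow_natCast, ← rpow_mul ht0.le]; norm_num
  have hr0 : 1 ≤ t ^ (1 / 2 : ℝ) := one_le_rpow ht (by norm_num)
  set r := t ^ (1 / 2 : ℝ)
  have hl2 : log t ^ 2 ≤ 4 * t := by
    calc log t ^ 2 ≤ (r / (1 / 2)) ^ 2 := by gcongr
      _ = 4 * t := by rw [← hr]; ring
  have hl1 : log t ≤ 2 * t := by nlinarith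
  have hq0 : 0 ≤ A * log t ^ 2 + B * log t + C := by positivity
  have hq : A * log t ^ 2 + B * log t + C ≤ t * (4 * A + 2 * B + C) := by
    nlinarith [mul_le_mul_of_nonneg_left hl2 hA, mul_le_mul_of_nonneg_left hl1 hB]
  have hp : 0 < t ^ (-(5 / 4) : ℝ) := rpow_pos_of_pos ht0 _
  rw [norm_neg, norm_of_nonneg (by positivity)]
  calc t ^ (-(5 / 4) : ℝ) * (A * log t ^ 2 + B * log t + C)
      ≤ t ^ (-(5 / 4) : ℝ) * (t * (4 * A + 2 * B + C)) := by gcongr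
    _ = t ^ (-(1 / 4) : ℝ) * (4 * A + 2 * B + C) := by
      rw [← mul_assoc, ← rpow_add_one ht0.ne']; norm_num

/-- Parametrised by the coefficients of the antiderivative, so that a given integrand requires only
a triangular linear system for A, B, C. -/
theorem hasDerivAt_rpow_mul_quadratic_log (A B C : ℝ) {t : ℝ} (ht : 0 < t) :
    HasDerivAt (fun t => -(t ^ (-(5 / 4) : ℝ) * (A * log t ^ 2 + B * log t + C)))
      (t ^ (-(9 / 4) : ℝ) * (5 / 4 * A * log t ^ 2 + (5 / 4 * B - 2 * A) * log t +
        (5 / 4 * C - B))) t := by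
  refine HasDerivAt.congr_deriv (((hasDerivAt_rpow_const (Or.inl ht.ne')).mul
    (((((hasDerivAt_log ht.ne').pow 2).const_mul A).add
    ((hasDerivAt_log ht.ne').const_mul B)).add_const C)).neg) ?_
  have h1 : t ^ (-(5 / 4) : ℝ) = t * t ^ (-(9 / 4) : ℝ) := by
    rw [← rpow_one_add' ht.le (by norm_num)]; norm_num
  have h2 : t ^ (-(5 / 4) - 1 : ℝ) = t ^ (-(9 / 4) : ℝ) := by norm_num
  rw [h2, h1]
  simp only [Pi.add_apply, Pi.pow_apply]
  field_simp
  push_cast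
  ring

theorem integral_rpow_mul_quadratic_log {A B C c : ℝ} (hA : 0 ≤ A) (hB : 0 ≤ B) (hC : 0 ≤ C)
    (hc : 0 < c) (hpos : ∀ t, c < t → 0 ≤ 5 / 4 * A * log t ^ 2 + (5 / 4 * B - 2 * A) * log t +
        (5 / 4 * C - B)) :
    IntegrableOn (fun t => t ^ (-(9 / 4) : ℝ) * (5 / 4 * A * log t ^ 2 +
        (5 / 4 * B - 2 * A) * log t + (5 / 4 * C - B))) (Ioi c) ∧
      ∫ t in Ioi c, t ^ (-(9 / 4) : ℝ) * (5 / 4 * A * log t ^ 2 +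
        (5 / 4 * B - 2 * A) * log t + (5 / 4 * C - B)) =
        c ^ (-(5 / 4) : ℝ) * (A * log c ^ 2 + B * log c + C) := by
  have hd := fun t (ht : 0 < t) => hasDerivAt_rpow_mul_quadratic_log A B C ht
  have hlim := tendsto_rpow_mul_quadratic_log A B C hA hB hC
  have hi := integrableOn_Ioi_deriv_of_nonneg (hd c hc).continuousAt.continuousWithinAt
    (fun t ht => hd t (hc.trans ht)) (fun t ht => mul_nonneg
      (rpow_nonneg (hc.trans ht).le _) (hpos t ht)) hlim
  refine ⟨hi, ?_⟩
  rw [integral_Ioi_of_hasDerivAt_of_tendsto (hd c hc).continuousAt.continuousWithinAt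
    (fun t ht => hd t (hc.trans ht)) hi hlim]
  ring

/-- The tail weight in the lower bound for the curvature. -/
noncomputable def tailWeight (t : ℝ) : ℝ := curvature (9 / 4 * log t)

/-- The numbers 81/20, 117/25, 443/125 solve that system for the coefficients 81/16, -9/4, -1/4 of
the curvature quadratic at x = (9/4) log t. -/
theorem tailWeight_eq {t : ℝ} (ht : 0 < t) :
    tailWeight t = t ^ (-(9 / 4) : ℝ) * (5 / 4 * (81 / 20) * log t ^ 2 +
        (5 / 4 * (117 / 25) - 2 * (81 / 20)) * log t + (5 / 4 * (443 / 125) - 117 / 25)) := by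
  rw [tailWeight, curvature, exp_neg_mul_log ht]
  ring

theorem tailWeight_nonneg {t : ℝ} (ht : 9 / 2 < t) : 0 ≤ tailWeight t :=
  curvature_nonneg (by linarith [three_halves_le_log ht.le])

theorem tailWeight_antitoneOn : AntitoneOn tailWeight (Ioi (9 / 2)) := by
  intro x hx y hy hxy
  have hx' : (9 / 2 : ℝ) < x := hx
  have hy' : (9 / 2 : ℝ) < y := hy
  have h1 := three_halves_le_log hx'.le
  have h2 := log_le_log (by linarith) hxy
  exact curvature_antitoneOn (mem_Ici.2 (by linarith)) (mem_Ici.2 (by linarith)) (by linarith)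

theorem integral_tailWeight {c : ℝ} (hc : 9 / 2 ≤ c) :
    IntegrableOn tailWeight (Ioi c) ∧ ∫ t in Ioi c, tailWeight t =
      c ^ (-(5 / 4) : ℝ) * (81 / 20 * log c ^ 2 + 117 / 25 * log c + 443 / 125) := by
  have hc0 : 0 < c := by linarith
  have h := integral_rpow_mul_quadratic_log (A := 81 / 20) (B := 117 / 25) (C := 443 / 125)
    (by norm_num) (by norm_num) (by norm_num) hc0 (fun t ht => by
      have := three_halves_le_log (hc.trans (le_of_lt ht))
      nlinarith)
  have heq : ∀ t ∈ Ioi c, tailWeight t = _ := fun t ht => tailWeight_eq (hc0.trans ht)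
  exact ⟨h.1.congr_fun (fun t ht => (heq t ht).symm) measurableSet_Ioi,
    (setIntegral_congr_fun measurableSet_Ioi heq).trans h.2⟩

/-- A lower bound, uniform in `p`, for the curvature of `√p * absSinc t ^ p`. -/
noncomputable def curvatureMinorant (t : ℝ) : ℝ :=
  (Ioc 0 2).indicator (fun _ => -(7 / 20)) t +
    (Ioi (9 / 2)).indicator (fun t => |sin t| ^ (9 / 4 : ℝ) * tailWeight t) t

theorem integrableOn_sin_mul_tailWeight :
    IntegrableOn (fun t => |sin t| ^ (9 / 4 : ℝ) * tailWeight t) (Ioi (9 / 2)) := by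
  refine Integrable.bdd_mul (c := 1) (integral_tailWeight le_rfl).1
    (measurable_sin.abs.pow_const _).aestronglyMeasurable (ae_of_all _ fun t => ?_)
  rw [norm_of_nonneg (rpow_nonneg (abs_nonneg _) _)]
  exact rpow_le_one (abs_nonneg _) (abs_sin_le_one t) (by norm_num)

theorem integral_curvatureMinorant :
    IntegrableOn curvatureMinorant (Ioi 0) ∧ 0 ≤ ∫ t in Ioi (0 : ℝ), curvatureMinorant t := by
  have i1 : IntegrableOn ((Ioc 0 2).indicator fun _ : ℝ => (-(7 / 20) : ℝ)) (Ioi 0) := by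
    refine ((integrable_indicator_iff measurableSet_Ioc).2 ?_).integrableOn
    simp
  have i2 : IntegrableOn ((Ioi (9 / 2)).indicator
      (fun t => |sin t| ^ (9 / 4 : ℝ) * tailWeight t)) (Ioi 0) :=
    ((integrable_indicator_iff measurableSet_Ioi).2 integrableOn_sin_mul_tailWeight).integrableOn
  refine ⟨i1.add i2, ?_⟩
  have hs := integral_add i1 i2
  have h1 : ∫ t in Ioi (0 : ℝ), (Ioc 0 2).indicator (fun _ : ℝ => (-(7 / 20) : ℝ)) t =
      -(7 / 10) := by
    rw [setIntegral_indicator measurableSet_Ioc, inter_eq_right.2 Ioc_subset_Ioi_self]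
    simp
    norm_num
  -- The tail must repay the loss 2 · 7/20 near the origin. Quarter-period averaging yields at least
  -- 9/20 · 0.104 · 19.6 ≈ 0.92.
  have h2 : 7 / 10 ≤ ∫ t in Ioi (0 : ℝ), (Ioi (9 / 2)).indicator
      (fun t => |sin t| ^ (9 / 4 : ℝ) * tailWeight t) t := by
    rw [setIntegral_indicator measurableSet_Ioi,
      inter_eq_right.2 (Ioi_subset_Ioi (by norm_num))]
    refine le_trans ?_ (integral_sin_rpow_mul_tail_ge tailWeight_antitoneOn
      (fun t ht => tailWeight_nonneg ht) (integral_tailWeight le_rfl).1)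
    have hc : (9 / 2 : ℝ) ≤ 9 / 2 + π / 2 := by linarith [pi_pos]
    rw [(integral_tailWeight hc).2]
    have hl := three_halves_le_log hc
    have hcp : 104 / 1000 ≤ (9 / 2 + π / 2) ^ (-(5 / 4) : ℝ) := by
      refine le_rpow_of_pow_four_le (by positivity) (by norm_num) (-5) (by norm_num) ?_
      rw [zpow_neg, zpow_ofNat]
      refine le_inv_of_le_inv₀ (by positivity) ?_
      calc (9 / 2 + π / 2) ^ 5 ≤ (9 / 2 + 3.1416 / 2) ^ 5 := by gcongr; exact pi_lt_d4.le
        _ ≤ _ := by norm_num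
    have hq : 196 / 10 ≤ 81 / 20 * log (9 / 2 + π / 2) ^ 2 + 117 / 25 * log (9 / 2 + π / 2) +
        443 / 125 := by nlinarith
    have := mul_le_mul hcp hq (by norm_num) (by linarith)
    linarith
  have e : ∫ t in Ioi (0 : ℝ), curvatureMinorant t = _ := hs
  rw [e, h1]
  linarith

/-- At zeros of s the description by -log s breaks down. There s^p vanishes for every p > 0, and k =
0 makes the corrected integrand identically zero, hence convex. -/
theorem curvatureMinorant_eq_zero {t : ℝ} (ht : 0 < t) (h : absSinc t = 0) :
    curvatureMinorant t = 0 := by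
  have h2 : 2 < t := by
    by_contra hle
    exact (absSinc_pos ht (by linarith [pi_gt_three])).ne' h
  have hs : sin t = 0 := by
    rw [absSinc_eq ht, div_eq_zero_iff, abs_eq_zero] at h
    exact h.resolve_right ht.ne'
  rw [curvatureMinorant, indicator_of_notMem (fun hm => absurd hm.2 (not_le.2 h2)), zero_add]
  by_cases hm : t ∈ Ioi (9 / 2 : ℝ)
  · rw [indicator_of_mem hm, hs, abs_zero, zero_rpow (by norm_num), zero_mul]
  · rw [indicator_of_notMem hm]

theorem log_le_neg_log_absSinc {t : ℝ} (ht : 0 < t) (h : 0 < absSinc t) :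
    log t ≤ -log (absSinc t) := by
  rw [← log_inv]
  exact log_le_log ht (le_inv_of_le_inv₀ h (absSinc_le_inv ht))

/-- Let l = -log s; s ≤ 1/t gives l ≥ log t. Up to t = 2 the global minimum bound is used. On (2,
9/2], pl ≥ 1.914 log 2 > 5/4, where the curvature is nonnegative. Beyond, it decreases, so p = 9/4
is the worst case; then e^{-9l/4} = |sin t|^(9/4) t^(-9/4), and l is lowered to log t in the
quadratic factor. -/
theorem curvatureMinorant_le {p t : ℝ} (hp : 1914 / 1000 ≤ p) (hp' : p ≤ 9 / 4) (ht : 0 < t)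
    (h : 0 < absSinc t) : curvatureMinorant t ≤ curvature (p * -log (absSinc t)) := by
  have hL := log_le_neg_log_absSinc ht h
  have hL0 : 0 ≤ -log (absSinc t) := by
    linarith [log_nonpos h.le (absSinc_le_one t)]
  have hp0 : 0 ≤ p := by linarith
  rw [curvatureMinorant]
  rcases le_or_gt t 2 with h2 | h2
  · rw [indicator_of_mem (mem_Ioc.2 ⟨ht, h2⟩),
      indicator_of_notMem (fun hm => by linarith [mem_Ioi.1 hm]), add_zero]
    exact curvature_ge (mul_nonneg hp0 hL0)
  rw [indicator_of_notMem (fun hm => absurd hm.2 (not_le.2 h2)), zero_add]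
  rcases le_or_gt t (9 / 2) with h9 | h9
  · rw [indicator_of_notMem (show t ∉ Ioi (9 / 2 : ℝ) from not_lt.2 h9)]
    have hl2 : log 2 ≤ log t := log_le_log two_pos h2.le
    have := log_two_gt_d9
    exact curvature_nonneg (by nlinarith)
  · rw [indicator_of_mem (mem_Ioi.2 h9)]
    have hl := three_halves_le_log h9.le
    set L := -log (absSinc t) with hLdef
    have h1 : curvature (9 / 4 * L) ≤ curvature (p * L) :=
      curvature_antitoneOn (mem_Ici.2 (by nlinarith)) (mem_Ici.2 (by linarith))
        (mul_le_mul_of_nonneg_right hp' hL0)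
    refine le_trans ?_ h1
    have hexp : exp (-(9 / 4 * L)) = |sin t| ^ (9 / 4 : ℝ) * exp (-(9 / 4 * log t)) := by
      rw [exp_neg_mul_log ht, ← absSinc_rpow_eq ht, rpow_def_of_pos h, hLdef]
      ring_nf
    rw [tailWeight, curvature, curvature, hexp]
    have hq : (9 / 4 * log t) ^ 2 - 9 / 4 * log t - 1 / 4 ≤
        (9 / 4 * L) ^ 2 - 9 / 4 * L - 1 / 4 := by nlinarith
    have hE : 0 ≤ |sin t| ^ (9 / 4 : ℝ) * exp (-(9 / 4 * log t)) :=
      mul_nonneg (rpow_nonneg (abs_nonneg _) _) (exp_pos _).le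
    nlinarith [mul_le_mul_of_nonneg_right hq hE]

theorem convexOn_setIntegral {H : ℝ → ℝ → ℝ} {s S : Set ℝ} (hs : Convex ℝ s)
    (hS : MeasurableSet S) (hint : ∀ p ∈ s, IntegrableOn (H p) S)
    (hconv : ∀ t ∈ S, ConvexOn ℝ s fun p => H p t) :
    ConvexOn ℝ s fun p => ∫ t in S, H p t := by
  refine ⟨hs, fun p hp q hq a b ha hb hab => ?_⟩
  simp only [smul_eq_mul]
  rw [← integral_const_mul, ← integral_const_mul,
    ← integral_add ((hint p hp).const_mul a) ((hint q hq).const_mul b)]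
  exact setIntegral_mono_on (hint _ (hs hp hq ha hb hab))
    (((hint p hp).const_mul a).add ((hint q hq).const_mul b)) hS
    fun t ht => (hconv t ht).2 hp hq ha hb hab

/-- As (4k√p)'' = -k p^{-3/2}, the second derivative of the sum is (c(pl) - k)/p^{3/2}, with c the
`curvature`. -/
theorem convexOn_sqrt_mul_exp_add {l k a b : ℝ} (ha : 0 < a)
    (hk : ∀ p, a ≤ p → p ≤ b → k ≤ curvature (p * l)) :
    ConvexOn ℝ (Icc a b) fun p => √p * exp (-(p * l)) + 4 * k * √p := by
  have hE : ∀ p : ℝ, HasDerivAt (fun p => exp (-(p * l))) (-l * exp (-(p * l))) p := fun p => by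
    refine HasDerivAt.congr_deriv (((hasDerivAt_id p).mul_const l).neg.exp) ?_
    simp only [Pi.neg_apply, id]
    ring
  have hd1 : ∀ p ∈ interior (Icc a b), HasDerivAt
      (fun p => √p * exp (-(p * l)) + 4 * k * √p)
      (1 / (2 * √p) * (exp (-(p * l)) + 4 * k) - l * (√p * exp (-(p * l)))) p := by
    intro p hp
    rw [interior_Icc] at hp
    have hs := hasDerivAt_sqrt (ha.trans hp.1).ne'
    exact ((hs.mul (hE p)).add (hs.const_mul (4 * k))).congr_deriv (by ring)
  have hd2 : ∀ p ∈ interior (Icc a b), HasDerivAt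
      (fun p => 1 / (2 * √p) * (exp (-(p * l)) + 4 * k) - l * (√p * exp (-(p * l))))
      ((curvature (p * l) - k) / (p * √p)) p := by
    intro p hp
    rw [interior_Icc] at hp
    have hp0 := ha.trans hp.1
    have hs := hasDerivAt_sqrt hp0.ne'
    have hr : 0 < √p := sqrt_pos.2 hp0
    have hinv : HasDerivAt (fun p => 1 / (2 * √p)) (-(1 / (4 * (p * √p)))) p := by
      refine HasDerivAt.congr_deriv (((hs.const_mul 2).inv (by positivity)).congr_of_eventuallyEq
        (Eventually.of_forall fun x => one_div _)) ?_
      have hsq : √p ^ 2 = p := sq_sqrt hp0.le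
      field_simp
      rw [hsq]
      ring
    refine ((hinv.mul ((hE p).add_const (4 * k))).sub ((hs.mul (hE p)).const_mul l)).congr_deriv ?_
    have hsq : √p ^ 2 = p := sq_sqrt hp0.le
    rw [curvature]
    generalize exp (-(p * l)) = E
    generalize √p = r at *
    subst hsq
    field_simp
    ring
  refine convexOn_of_hasDerivWithinAt2_nonneg (convex_Icc a b) ?_
    (fun p hp => (hd1 p hp).hasDerivWithinAt) (fun p hp => (hd2 p hp).hasDerivWithinAt) ?_
  · fun_prop
  · intro p hp
    rw [interior_Icc] at hp
    have hp0 := ha.trans hp.1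
    have := hk p hp.1.le hp.2.le
    exact div_nonneg (by linarith) (by positivity)

theorem ballFunction_convexOn : ConvexOn ℝ (Icc (√2 + 1 / 2) (9 / 4)) ballFunction := by
  have hl := sqrt_two_bounds.1
  have ha : 0 < √2 + 1 / 2 := by positivity
  obtain ⟨hki, hk0⟩ := integral_curvatureMinorant
  set s := Icc (√2 + 1 / 2) (9 / 4) with hsdef
  have hI : ∀ p ∈ s, IntegrableOn (fun t => √p * absSinc t ^ p) (Ioi 0) := fun p hp =>
    (integrableOn_absSinc_rpow (by linarith [hp.1])).const_mul _
  have hK : ∀ p : ℝ, IntegrableOn (fun t => 4 * curvatureMinorant t * √p) (Ioi 0) := fun p =>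
    (hki.const_mul 4).mul_const _
  have hconv := convexOn_setIntegral (H := fun p t => √p * absSinc t ^ p +
      4 * curvatureMinorant t * √p) (S := Ioi 0) (convex_Icc (√2 + 1 / 2) (9 / 4))
      measurableSet_Ioi (fun p hp => (hI p hp).add (hK p)) (fun t ht => by
    rcases (absSinc_nonneg t).eq_or_lt with h0 | h0
    · refine (convexOn_const 0 (convex_Icc _ _)).congr fun p hp => ?_
      have hp0 : p ≠ 0 := (ha.trans_le hp.1).ne'
      simp only
      rw [← h0, zero_rpow hp0, curvatureMinorant_eq_zero ht h0.symm]
      ring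
    · refine (convexOn_sqrt_mul_exp_add (l := -log (absSinc t)) (k := curvatureMinorant t)
        (b := 9 / 4) ha fun p hp hp' => curvatureMinorant_le (by linarith) hp' ht h0).congr
        fun p hp => ?_
      simp only
      rw [rpow_def_of_pos h0]
      ring_nf)
  -- Removes the correction after integration; convex because the integral of the minorant is
  -- nonnegative and √p is concave.
  have hsqrt : ConvexOn ℝ s fun p => (4 * ∫ t in Ioi (0 : ℝ), curvatureMinorant t) * -√p := by
    refine ConvexOn.smul (by positivity) ?_
    exact (strictConcaveOn_sqrt.concaveOn.subset (fun p hp => mem_Ici.2 (ha.le.trans hp.1))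
      (convex_Icc _ _)).neg
  have hsum := ((hconv.add hsqrt).smul (c := 1 / √2 * (2 / π)) (by positivity))
  refine hsum.congr fun p hp => ?_
  simp only [Pi.add_apply, smul_eq_mul]
  rw [integral_add (hI p hp) (hK p), integral_const_mul, integral_mul_const, integral_const_mul,
    ballFunction_eq, sincIntegral, sqrt_div (ha.le.trans hp.1)]
  ring

/-! ### Strict decrease -/

theorem mul_exp_neg_antitoneOn : AntitoneOn (fun x : ℝ => x * exp (-x)) (Ici 1) := by
  have hd : ∀ x : ℝ, HasDerivAt (fun x : ℝ => x * exp (-x)) ((1 - x) * exp (-x)) x := fun x => by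
    refine HasDerivAt.congr_deriv ((hasDerivAt_id x).mul (hasDerivAt_neg x).exp) ?_
    simp only [id]
    ring
  apply antitoneOn_of_deriv_nonpos (convex_Ici _)
  · exact fun y _ => (hd y).continuousAt.continuousWithinAt
  · exact fun y _ => (hd y).differentiableAt.differentiableWithinAt
  · intro y hy
    rw [interior_Ici] at hy
    have : (1 : ℝ) < y := hy
    rw [(hd y).deriv]
    exact mul_nonpos_of_nonpos_of_nonneg (by linarith) (exp_pos _).le

theorem one_le_log {t : ℝ} (ht : π ≤ t) : 1 ≤ log t := by
  rw [le_log_iff_exp_le (by linarith [pi_pos])]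
  linarith [exp_one_lt_d9, pi_gt_three]

theorem rpow_mul_log_antitoneOn :
    AntitoneOn (fun t : ℝ => t ^ (-(9 / 4) : ℝ) * log t) (Ioi π) := by
  intro x hx y hy hxy
  have hx0 : 0 < x := pi_pos.trans hx
  have hy0 : 0 < y := pi_pos.trans hy
  have h1 := one_le_log (le_of_lt hx)
  have h2 := log_le_log hx0 hxy
  have := mul_exp_neg_antitoneOn (a := 9 / 4 * log x) (b := 9 / 4 * log y)
    (mem_Ici.2 (by linarith)) (mem_Ici.2 (by linarith)) (by linarith)
  simp only [exp_neg_mul_log hx0, exp_neg_mul_log hy0] at this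
  simp only
  linarith

theorem integral_rpow_mul_log {c : ℝ} (hc : π ≤ c) :
    IntegrableOn (fun t : ℝ => t ^ (-(9 / 4) : ℝ) * log t) (Ioi c) ∧
      ∫ t in Ioi c, t ^ (-(9 / 4) : ℝ) * log t =
        c ^ (-(5 / 4) : ℝ) * (4 / 5 * log c + 16 / 25) := by
  have h := integral_rpow_mul_quadratic_log (A := 0) (B := 4 / 5) (C := 16 / 25)
    le_rfl (by norm_num) (by norm_num) (pi_pos.trans_le hc) (fun t ht => by
      have := one_le_log (hc.trans (le_of_lt ht))
      linarith)
  norm_num at h ⊢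
  exact h

/-- Coefficients of a minorant of `-log s * s ^ (9 / 4)`, `s = absSinc t`, on `(0, 3)`. -/
noncomputable def logMinorant : List ℝ :=
  [0, 1/6, -41/720, 71/11520, -2927/7257600, 3377/24883200, -11843/387072000,
    191327/73156608000, 522919/5852528640000, -1652741/35115171840000, 1966453/327741603840000,
    -4670557/9832248115200000, 15860939/589934886912000000, -5656001/4955453050060800000,
    18293869/495545305006080000000, -538999/594654366007296000000, 4913/297327183003648000000,
    -19/89198154901094400000, 1/570868191367004160000, -1/142717047841751040000000]

/-- The first two coefficients are those of the binomial series; 21/32 makes the left side vanish at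
s = 0. With s = r⁴ the difference is r(1-r)³ times a polynomial with positive coefficients. -/
theorem cubic_le_rpow {s : ℝ} (h0 : 0 ≤ s) (h1 : s ≤ 1) :
    1 - 1 / 4 * (1 - s) - 3 / 32 * (1 - s) ^ 2 - 21 / 32 * (1 - s) ^ 3 ≤ s ^ (1 / 4 : ℝ) := by
  have hr0 : 0 ≤ s ^ (1 / 4 : ℝ) := rpow_nonneg h0 _
  have hr1 : s ^ (1 / 4 : ℝ) ≤ 1 := rpow_le_one h0 h1 (by norm_num)
  have hs : s = (s ^ (1 / 4 : ℝ)) ^ 4 := by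
    rw [← rpow_natCast, ← rpow_mul h0]; norm_num
  generalize s ^ (1 / 4 : ℝ) = r at *
  subst hs
  have h3 : 0 ≤ (1 - r) ^ 3 := pow_nonneg (by linarith) 3
  have : 0 ≤ r * (1 - r) ^ 3 * (1 + 3 * r + 6 * r ^ 2 + 243 / 32 * r ^ 3 + 249 / 32 * r ^ 4 +
    105 / 16 * r ^ 5 + 63 / 16 * r ^ 6 + 63 / 32 * r ^ 7 + 21 / 32 * r ^ 8) := by positivity
  linarith

theorem logMinorant_le {t : ℝ} (ht : 0 < t) (h : t < 3) :
    evenPoly logMinorant t ≤ -log (absSinc t) * absSinc t ^ (9 / 4 : ℝ) := by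
  have h3 : t ≤ π := by linarith [pi_gt_three]
  have hs0 := absSinc_pos ht (by linarith [pi_gt_three])
  have hs1 := absSinc_le_one t
  have hlow := absSinc_ge ht h3
  have hup := absSinc_le_quartic ht h3
  have hl0 := absSinc_minorant_nonneg ht h
  have hlog := neg_log_ge_quadratic hs0 hs1
  have hr := cubic_le_rpow hs0.le hs1
  set s := absSinc t
  have hsplit : s ^ (9 / 4 : ℝ) = s ^ 2 * s ^ (1 / 4 : ℝ) := by
    rw [← rpow_two, ← rpow_add hs0]; norm_num
  have hz : t ^ 2 ≤ 9 := by nlinarith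
  have hU0 : 0 ≤ t ^ 2 / 6 - t ^ 4 / 120 := by nlinarith [sq_nonneg t]
  have hU : t ^ 2 / 6 - t ^ 4 / 120 ≤ 1 - s := by linarith
  have hU2 := pow_le_pow_left₀ hU0 hU 2
  set V := t ^ 2 / 6 - t ^ 4 / 120 + t ^ 6 / 5040 with hVdef
  have hu0 : 0 ≤ 1 - s := by linarith
  have hV : 1 - s ≤ V := by linarith
  have hV1 : V ≤ 1 := by linarith
  have hV0 : 0 ≤ V := by linarith
  have hN0 : 0 ≤ 1 - 1 / 4 * V - 3 / 32 * V ^ 2 - 21 / 32 * V ^ 3 := by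
    have := pow_le_one₀ (n := 2) hV0 hV1
    have := pow_le_one₀ (n := 3) hV0 hV1
    linarith
  have hN : 1 - 1 / 4 * V - 3 / 32 * V ^ 2 - 21 / 32 * V ^ 3 ≤ s ^ (1 / 4 : ℝ) := by
    have := pow_le_pow_left₀ hu0 hV 2
    have := pow_le_pow_left₀ hu0 hV 3
    linarith
  have hW0 : 0 ≤ (t ^ 2 / 6 - t ^ 4 / 120) + (t ^ 2 / 6 - t ^ 4 / 120) ^ 2 / 2 := by positivity
  rw [hsplit]
  calc evenPoly logMinorant t
      = ((t ^ 2 / 6 - t ^ 4 / 120) + (t ^ 2 / 6 - t ^ 4 / 120) ^ 2 / 2) *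
        ((1 - t ^ 2 / 6 + t ^ 4 / 120 - t ^ 6 / 5040) ^ 2 *
        (1 - 1 / 4 * V - 3 / 32 * V ^ 2 - 21 / 32 * V ^ 3)) := by
        simp only [evenPoly, logMinorant, hVdef]; ring
    _ ≤ -log s * (s ^ 2 * s ^ (1 / 4 : ℝ)) := by
        refine mul_le_mul (by linarith) (mul_le_mul (pow_le_pow_left₀ hl0 hlow 2) hN hN0
          (by positivity)) (by positivity) (by linarith)

theorem logMinorant_integral : 215 / 1000 ≤ ∫ t in Ioo (0 : ℝ) 3, evenPoly logMinorant t := by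
  rw [integral_evenPoly _ (by norm_num)]
  norm_num [evenPolyPrim, logMinorant]

/-- A lower bound for `-log s * s ^ (9 / 4)`, `s = absSinc t`. -/
noncomputable def slopeMinorant (t : ℝ) : ℝ :=
  (Ioo 0 3).indicator (evenPoly logMinorant) t +
    (Ioi π).indicator (fun t => |sin t| ^ (9 / 4 : ℝ) * (t ^ (-(9 / 4) : ℝ) * log t)) t

theorem slopeMinorant_le {t : ℝ} (ht : 0 < t) :
    slopeMinorant t ≤ -log (absSinc t) * absSinc t ^ (9 / 4 : ℝ) := by
  have hL0 : 0 ≤ -log (absSinc t) := by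
    linarith [log_nonpos (absSinc_nonneg t) (absSinc_le_one t)]
  have hnn := mul_nonneg hL0 (absSinc_rpow_nonneg (9 / 4) t)
  rw [slopeMinorant]
  by_cases h3 : t < 3
  · rw [indicator_of_mem (mem_Ioo.2 ⟨ht, h3⟩), indicator_of_notMem
      (fun hm => by linarith [mem_Ioi.1 hm, pi_gt_three]), add_zero]
    exact logMinorant_le ht h3
  rw [indicator_of_notMem (fun hm => h3 hm.2), zero_add]
  by_cases hpi : t ∈ Ioi π
  · rw [indicator_of_mem hpi]
    rcases (absSinc_nonneg t).eq_or_lt with h0 | h0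
    · have hs : sin t = 0 := by
        rw [absSinc_eq ht, eq_comm, div_eq_zero_iff, abs_eq_zero] at h0
        exact h0.resolve_right ht.ne'
      rw [hs, abs_zero, zero_rpow (by norm_num), zero_mul]
      exact hnn
    · have := mul_le_mul_of_nonneg_right (log_le_neg_log_absSinc ht h0)
        (absSinc_rpow_nonneg (9 / 4) t)
      refine le_trans (le_of_eq ?_) this
      rw [absSinc_rpow_eq ht]
      ring
  · rw [indicator_of_notMem hpi]
    exact hnn

theorem integral_slopeMinorant :
    IntegrableOn slopeMinorant (Ioi 0) ∧ 333 / 1000 ≤ ∫ t in Ioi (0 : ℝ), slopeMinorant t := by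
  have hw := integral_rpow_mul_log le_rfl
  have i1 : IntegrableOn ((Ioo 0 3).indicator (evenPoly logMinorant)) (Ioi 0) :=
    ((integrable_indicator_iff measurableSet_Ioo).2
      (integrableOn_evenPoly logMinorant 3)).integrableOn
  have i2 : IntegrableOn ((Ioi π).indicator
      (fun t => |sin t| ^ (9 / 4 : ℝ) * (t ^ (-(9 / 4) : ℝ) * log t))) (Ioi 0) := by
    refine ((integrable_indicator_iff measurableSet_Ioi).2 ?_).integrableOn
    refine Integrable.bdd_mul (c := 1) hw.1
      (measurable_sin.abs.pow_const _).aestronglyMeasurable (ae_of_all _ fun t => ?_)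
    rw [norm_of_nonneg (rpow_nonneg (abs_nonneg _) _)]
    exact rpow_le_one (abs_nonneg _) (abs_sin_le_one t) (by norm_num)
  refine ⟨i1.add i2, ?_⟩
  have e : ∫ t in Ioi (0 : ℝ), slopeMinorant t = _ := integral_add i1 i2
  have h1 := logMinorant_integral
  rw [e, setIntegral_indicator measurableSet_Ioo, inter_eq_right.2 Ioo_subset_Ioi_self,
    setIntegral_indicator measurableSet_Ioi, inter_eq_right.2 (Ioi_subset_Ioi pi_pos.le)]
  have h2 := integral_sin_rpow_mul_tail_ge rpow_mul_log_antitoneOn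
    (fun t ht => mul_nonneg (rpow_nonneg (pi_pos.trans ht).le _)
      (by linarith [one_le_log (le_of_lt ht)])) hw.1
  have hc : π ≤ π + π / 2 := by linarith [pi_pos]
  rw [(integral_rpow_mul_log hc).2] at h2
  have hl := three_halves_le_log (t := π + π / 2) (by linarith [pi_gt_three])
  have hcp : 1438 / 10000 ≤ (π + π / 2) ^ (-(5 / 4) : ℝ) := by
    have hpi := pi_pos
    refine le_rpow_of_pow_four_le (by positivity) (by norm_num) (-5) (by norm_num) ?_
    rw [zpow_neg, zpow_ofNat]
    refine le_inv_of_le_inv₀ (by positivity) ?_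
    calc (π + π / 2) ^ 5 ≤ (3.1416 + 3.1416 / 2) ^ 5 := by gcongr <;> exact pi_lt_d4.le
      _ ≤ _ := by norm_num
  have hq : 184 / 100 ≤ 4 / 5 * log (π + π / 2) + 16 / 25 := by linarith
  have := mul_le_mul hcp hq (by norm_num) (by linarith)
  linarith

/-- Pointwise s^p = s^(9/4) e^y with y = -(9/4 - p) log s, and e^y ≥ 1 + y; the slope is the
integral of -log s · s^(9/4), at least 0.333. -/
theorem sincIntegral_ge_tangent {p : ℝ} (hp : 1 < p) (hp' : p ≤ 9 / 4) :
    sincIntegral (9 / 4) + (9 / 4 - p) * (333 / 1000) ≤ sincIntegral p := by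
  obtain ⟨hi, hm⟩ := integral_slopeMinorant
  have i9 := integrableOn_absSinc_rpow (p := 9 / 4) (by norm_num)
  have h := setIntegral_mono_on (i9.add (hi.const_mul (9 / 4 - p)))
    (integrableOn_absSinc_rpow hp) measurableSet_Ioi fun t ht => by
      have hslope := mul_le_mul_of_nonneg_left (slopeMinorant_le ht) (sub_nonneg.2 hp')
      rcases (absSinc_nonneg t).eq_or_lt with h0 | h0
      · rw [← h0, zero_rpow (by norm_num), mul_zero, mul_zero] at hslope
        simp only [Pi.add_apply]
        rw [← h0, zero_rpow (by norm_num), zero_rpow (by linarith)]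
        linarith
      · have hexp := add_one_le_exp ((9 / 4 - p) * -log (absSinc t))
        have hs : absSinc t ^ p =
            absSinc t ^ (9 / 4 : ℝ) * exp ((9 / 4 - p) * -log (absSinc t)) := by
          rw [rpow_def_of_pos h0, rpow_def_of_pos h0, ← exp_add]
          ring_nf
        have := mul_le_mul_of_nonneg_left hexp (absSinc_rpow_nonneg (9 / 4) t)
        simp only [Pi.add_apply]
        rw [hs]
        linarith
  have e := integral_add i9 (hi.const_mul (9 / 4 - p))
  simp only [Pi.add_apply] at h
  rw [e, integral_const_mul] at h
  have := mul_le_mul_of_nonneg_left hm (sub_nonneg.2 hp')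
  simp only [sincIntegral]
  linarith

/-- The relative slope of I is at least 0.333/1.4439 > 0.23, while √p has relative slope only 2/9 at
9/4. The restriction p > 11/5 keeps the higher-order terms below this margin. -/
theorem ballFunction_nine_fourths_lt_of_near {p : ℝ} (hp : 11 / 5 < p) (hp' : p < 9 / 4) :
    ballFunction (9 / 4) < ballFunction p := by
  have hpi := pi_pos
  have h1 := sincIntegral_ge_tangent (by linarith) hp'.le
  have h2 := sincIntegral_nine_fourths_le
  have h0 := sincIntegral_pos (p := 9 / 4) (by norm_num)
  set I := sincIntegral (9 / 4)
  have hI : I * (1 + 23 / 100 * (9 / 4 - p)) ≤ sincIntegral p := by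
    have : I ≤ 14439 / 10000 := by linarith [pi_lt_d4]
    nlinarith
  have hs : √(9 / 4 / 2) < √(p / 2) * (1 + 23 / 100 * (9 / 4 - p)) := by
    have hd : 0 < 1 + 23 / 100 * (9 / 4 - p) := by linarith
    rw [← div_lt_iff₀ hd]
    refine lt_sqrt_of_sq_lt ?_
    rw [div_pow, sq_sqrt (by norm_num), div_lt_iff₀ (by positivity)]
    nlinarith [mul_pos (sub_pos.2 hp) (sub_pos.2 hp')]
  rw [ballFunction_eq, ballFunction_eq]
  calc √(9 / 4 / 2) * (2 / π) * I
      < √(p / 2) * (1 + 23 / 100 * (9 / 4 - p)) * (2 / π) * I := by gcongr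
    _ = √(p / 2) * (2 / π) * (I * (1 + 23 / 100 * (9 / 4 - p))) := by ring
    _ ≤ √(p / 2) * (2 / π) * sincIntegral p := by gcongr

/-- If f x ≤ f b for some x < b, convexity forces f ≤ f b on [x, b], against the hypothesis near b.
So every slope to b is negative, and slopes increase from left to right. -/
theorem strictAntiOn_of_convexOn {f : ℝ → ℝ} {a b c : ℝ} (hf : ConvexOn ℝ (Icc a b) f)
    (hc : c < b) (hnear : ∀ p, c < p → p < b → f b < f p) : StrictAntiOn f (Icc a b) := by
  have hlt : ∀ x ∈ Icc a b, x < b → f b < f x := by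
    intro x hx hxb
    by_contra hle
    obtain ⟨y, hy1, hy2⟩ := exists_between (max_lt hxb hc)
    have h1 := hnear y ((le_max_right _ _).trans_lt hy1) hy2
    have hseg : y ∈ segment ℝ x b := by
      rw [segment_eq_Icc hxb.le]
      exact ⟨(le_max_left x c).trans hy1.le, hy2.le⟩
    have := hf.le_on_segment hx (right_mem_Icc.2 (hx.1.trans hx.2)) hseg
    rw [max_eq_right (not_lt.1 hle)] at this
    linarith
  intro x hx y hy hxy
  rcases hy.2.eq_or_lt with rfl | hyb
  · exact hlt x hx hxy
  · have h1 := hf.slope_mono_adjacent hx (right_mem_Icc.2 (hx.1.trans hx.2)) hxy hyb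
    have h2 := hlt y hy hyb
    have h3 : (f b - f y) / (b - y) < 0 := div_neg_of_neg_of_pos (by linarith) (by linarith)
    have h4 := h1.trans_lt h3
    rw [div_lt_iff₀ (by linarith)] at h4
    linarith

theorem ballFunction_strictAntiOn :
    StrictAntiOn ballFunction (Icc (√2 + 1 / 2) (9 / 4)) :=
  strictAntiOn_of_convexOn ballFunction_convexOn (c := 11 / 5) (by norm_num)
    fun _ hp hp' => ballFunction_nine_fourths_lt_of_near hp hp'

/-! ### The limit at infinity -/

theorem sqrt_mul_sincIntegral {p : ℝ} (hp : 0 < p) :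
    √p * sincIntegral p = ∫ x in Ioi (0 : ℝ), absSinc (x / √p) ^ p := by
  have h := integral_comp_mul_left_Ioi (fun t => absSinc t ^ p) 0
    (inv_pos.2 (sqrt_pos.2 hp))
  rw [inv_inv, mul_zero, smul_eq_mul] at h
  rw [sincIntegral, ← h]
  simp only [inv_mul_eq_div]

/-- For u = x/√p ≤ π the Gaussian majorant gives e^{-x²/12} ≤ 1/(1 + x²/12). For u > π, log u ≥ 1
gives u^(-p) ≤ u^(-2) e^{-(p-2)}, and p e^{-(p-2)} ≤ e bounds x² u^(-p) uniformly in p. -/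
theorem absSinc_div_sqrt_rpow_le {p x : ℝ} (hp : 2 ≤ p) (hx : 0 < x) :
    absSinc (x / √p) ^ p ≤ 12 * (1 + x ^ 2)⁻¹ := by
  have hp0 : 0 < p := by linarith
  have hr : 0 < √p := sqrt_pos.2 hp0
  have hu : 0 < x / √p := div_pos hx hr
  have hsq : p * (x / √p) ^ 2 = x ^ 2 := by
    rw [div_pow, sq_sqrt hp0.le]; field_simp
  rcases le_or_gt (x / √p) π with h | h
  · have h1 := rpow_le_rpow (absSinc_nonneg _) (absSinc_le_exp hu h) hp0.le
    refine h1.trans ?_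
    rw [← exp_mul, show -((x / √p) ^ 2 / 12) * p = -(x ^ 2 / 12) by rw [← hsq]; ring, exp_neg,
      ← div_eq_mul_inv, inv_eq_one_div, div_le_div_iff₀ (exp_pos _) (by positivity)]
    have := add_one_le_exp (x ^ 2 / 12)
    linarith
  · refine (absSinc_rpow_le hp0.le hu).trans ?_
    set u := x / √p
    have hu2 : u ^ (-p) = u ^ (-(2 : ℝ)) * u ^ (-(p - 2)) := by
      rw [← rpow_add hu]; congr 1; ring
    have h2 : u ^ (-(p - 2)) ≤ exp (-(p - 2)) := by
      rw [rpow_def_of_pos hu]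
      refine exp_le_exp.2 ?_
      nlinarith [one_le_log h.le]
    have h3 : p * exp (-(p - 2)) ≤ 10 := by
      have e1 := add_one_le_exp (p - 1)
      have e2 : exp (p - 1) * exp (-(p - 2)) = exp 1 := by rw [← exp_add]; ring_nf
      have e3 : p * exp (-(p - 2)) ≤ exp (p - 1) * exp (-(p - 2)) := by
        gcongr; linarith
      linarith [exp_one_lt_d9]
    have hx2 : 9 ≤ x ^ 2 := by
      rw [← hsq]
      nlinarith [pi_gt_three]
    have h4 : x ^ 2 * u ^ (-p) ≤ 10 := by
      rw [← hsq, hu2, rpow_neg hu.le, rpow_two]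
      have : p * u ^ 2 * ((u ^ 2)⁻¹ * u ^ (-(p - 2))) = p * u ^ (-(p - 2)) := by field_simp
      rw [this]
      exact (mul_le_mul_of_nonneg_left h2 hp0.le).trans h3
    rw [← div_eq_mul_inv, le_div_iff₀ (by positivity)]
    nlinarith [rpow_pos_of_pos hu (-p)]

/-- Taylor bounds squeeze g(p) = p(s(x/√p) - 1) to -x²/6, and then (1 + g(p)/p)^p tends to the
exponential of that limit. -/
theorem tendsto_absSinc_div_sqrt_rpow {x : ℝ} (hx : 0 < x) :
    Tendsto (fun p => absSinc (x / √p) ^ p) atTop (𝓝 (exp (-(1 / 6) * x ^ 2))) := by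
  have hg : Tendsto (fun p => p * (absSinc (x / √p) - 1)) atTop (𝓝 (-(1 / 6) * x ^ 2)) := by
    have hup : Tendsto (fun p : ℝ => -(1 / 6) * x ^ 2 + x ^ 4 / 120 * p⁻¹) atTop
        (𝓝 (-(1 / 6) * x ^ 2)) := by
      have := (tendsto_inv_atTop_zero.const_mul (x ^ 4 / 120)).const_add (-(1 / 6) * x ^ 2)
      rwa [mul_zero, add_zero] at this
    refine tendsto_of_tendsto_of_tendsto_of_le_of_le' tendsto_const_nhds hup ?_ ?_
    all_goals
      filter_upwards [eventually_ge_atTop (max 1 (x ^ 2))] with p hp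
      have hp0 : 0 < p := by linarith [le_max_left 1 (x ^ 2)]
      have hr : 0 < √p := sqrt_pos.2 hp0
      have hu : 0 < x / √p := div_pos hx hr
      have hu1 : x / √p ≤ 1 := by
        rw [div_le_one hr]
        exact le_sqrt_of_sq_le ((le_max_right _ _).trans hp)
      have hupi : x / √p ≤ π := by linarith [pi_gt_three]
      have hsq : p * (x / √p) ^ 2 = x ^ 2 := by
        rw [div_pow, sq_sqrt hp0.le]; field_simp
    · have h1 : 1 - (x / √p) ^ 2 / 6 ≤ absSinc (x / √p) := by
        rw [absSinc_eq_of_le_pi hu hupi, le_div_iff₀ hu]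
        linarith [sin_ge_sub_cube hu.le]
      nlinarith
    · have h1 := absSinc_le_quartic hu hupi
      have h4 : p * (x / √p) ^ 4 = x ^ 4 * p⁻¹ := by
        rw [div_pow, show √p ^ 4 = (√p ^ 2) ^ 2 by ring, sq_sqrt hp0.le]; field_simp
      have := mul_le_mul_of_nonneg_left h1 hp0.le
      linarith
  have := tendsto_one_add_rpow_exp_of_tendsto hg
  simpa using this

theorem tendsto_sqrt_mul_sincIntegral :
    Tendsto (fun p => √p * sincIntegral p) atTop (𝓝 (√(π / (1 / 6)) / 2)) := by
  rw [← integral_gaussian_Ioi]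
  have h := tendsto_integral_filter_of_dominated_convergence (l := atTop)
    (μ := volume.restrict (Ioi (0 : ℝ))) (F := fun p x => absSinc (x / √p) ^ p)
    (f := fun x => exp (-(1 / 6) * x ^ 2)) (fun x => 12 * (1 + x ^ 2)⁻¹)
    (Eventually.of_forall fun p => ((measurable_absSinc.comp
      (measurable_id.div_const _)).pow_const p).aestronglyMeasurable)
    (by
      filter_upwards [eventually_ge_atTop 2] with p hp
      refine (ae_restrict_iff' measurableSet_Ioi).2 (ae_of_all _ fun x hx => ?_)
      rw [norm_of_nonneg (absSinc_rpow_nonneg _ _)]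
      exact absSinc_div_sqrt_rpow_le hp hx)
    (integrable_inv_one_add_sq.const_mul 12).integrableOn
    ((ae_restrict_iff' measurableSet_Ioi).2 (ae_of_all _ fun x hx =>
      tendsto_absSinc_div_sqrt_rpow hx))
  refine h.congr' ?_
  filter_upwards [eventually_gt_atTop 0] with p hp
  exact (sqrt_mul_sincIntegral hp).symm

theorem tendsto_ballFunction : Tendsto ballFunction atTop (𝓝 √(3 / π)) := by
  have h := tendsto_sqrt_mul_sincIntegral.const_mul (1 / √2 * (2 / π))
  have hlim : 1 / √2 * (2 / π) * (√(π / (1 / 6)) / 2) = √(3 / π) := by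
    have hpi := pi_pos
    rw [eq_comm, sqrt_eq_iff_mul_self_eq (by positivity) (by positivity), ← sq]
    rw [mul_pow, mul_pow, div_pow, div_pow, div_pow, sq_sqrt (by positivity),
      sq_sqrt (by positivity)]
    field_simp
    norm_num
  rw [hlim] at h
  refine h.congr' ?_
  filter_upwards [eventually_ge_atTop 0] with p hp
  rw [ballFunction_eq, sqrt_div hp]
  ring

end BallFunction


/-- Ball's function is well defined and positive on `(1, ∞)`; (a) its limit at infinity and its
value at `9/4`; (b) its value at `√2 + 1/2`; (c) it is (strictly) decreasing and convex on
`[√2 + 1/2, 9/4]`. -/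
theorem proposition6 :
    (∀ p : ℝ, 1 < p →
      MeasureTheory.IntegrableOn (fun t : ℝ => |Real.sin t / t| ^ p) (Set.Ioi (0 : ℝ)) ∧
        0 < ballFunction p) ∧
    (Filter.Tendsto ballFunction Filter.atTop (nhds (Real.sqrt (3 / Real.pi))) ∧
      ballFunction (9 / 4) < Real.sqrt (3 / Real.pi)) ∧
    ballFunction (Real.sqrt 2 + 1 / 2) < 51 / 50 ∧
    (StrictAntiOn ballFunction (Set.Icc (Real.sqrt 2 + 1 / 2) (9 / 4)) ∧
      ConvexOn ℝ (Set.Icc (Real.sqrt 2 + 1 / 2) (9 / 4)) ballFunction) :=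
  ⟨fun _ hp => ⟨BallFunction.integrableOn_absSinc_rpow hp, BallFunction.ballFunction_pos hp⟩,
    ⟨BallFunction.tendsto_ballFunction, BallFunction.ballFunction_nine_fourths_lt⟩,
    BallFunction.ballFunction_sqrt_two_add_half_lt,
    BallFunction.ballFunction_strictAntiOn, BallFunction.ballFunction_convexOn⟩
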